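/- Let $(N,h)$ be a closed (compact, without boundary) smooth Riemannian manifold of dimension two. Let $H$ be a torus, i.e. a compact connected abelian Lie group, with Lie algebra $\mathfrak h=T_eH$, equipped with an invariant Riemannian metric, and denote by $\langle\cdot,\cdot\rangle$ its restriction to $\mathfrak h$. For a smooth $\mathfrak h$-valued $1$-form $\lambda$ on $N$ and $Z\in\mathfrak h$, let $\lambda_Z:=\langle\lambda(\cdot),Z\rangle$, a real-valued $1$-form on $N$. Identify $T_{(p,z)}(N\times H)$ with $T_pN\times\mathfrak h$ by translation in $H$, and let $g_\lambda$ be the Riemannian metric on $N\times H$ given by $$g_\lambda\big((X,V),(Y,W)\big)=h(X,Y)+\langle\lambda(X)+V,\lambda(Y)+W\rangle ;$$ equivalently, $g_\lambda$ induces the given invariant metric on each fiber $\{p\}\times H$, the projection $(N\times H,g_\lambda)\to(N,h)$ is a Riemannian submersion, and the vectors $(X,-\lambda(X))$ are horizontal. Let $\lambda,\lambda'$ be two smooth $\mathfrak h$-valued $1$-forms on $N$ such that for each $Z\in\mathfrak h$ there is an isometry $f_Z$ of $(N,h)$ with $\lambda'_Z=f_Z^*\lambda_Z$. Write $M=N\times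 H$, and denote by $\mathrm{scal}^g$ and $\mathrm{dvol}_g$ the scalar curvature function and the Riemannian measure of a metric $g$ on $M$. Then: (i) $\displaystyle\int_M(\mathrm{scal}^{g_\lambda})^k\,\mathrm{dvol}_{g_\lambda}=\int_M(\mathrm{scal}^{g_{\lambda'}})^k\,\mathrm{dvol}_{g_{\lambda'}}$ for all $k\in\mathbb N$ (both integrals being finite); (ii) the functions $\mathrm{scal}^{g_\lambda}$ and $\mathrm{scal}^{g_{\lambda'}}$ have the same range. -/

import Mathlib

open MeasureTheory Set Bundle
open scoped Manifold ContDiff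

/-! ## Fields of bilinear forms, curvature and volume -/

section Curvature

variable {V : Type*} [NormedAddCommGroup V] [NormedSpace ℝ V] [FiniteDimensional ℝ V]

/-- The Levi-Civita connection of a field `G` of nondegenerate symmetric bilinear forms on a
vector space `V`: the Christoffel map `Γ_y : V × V → V`, determined by
`G_y(Γ_y(u,v), w) = (∂_u G(v,w) + ∂_v G(u,w) - ∂_w G(u,v)) / 2`
(`inverse` is the inverse of the musical map `V → V*`, `v ↦ G_y(v, ·)`). -/
noncomputable def christoffel (G : V → V →L[ℝ] V →L[ℝ] ℝ) (y u v : V) : V :=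
  ContinuousLinearMap.inverse (G y)
    ((1 / 2 : ℝ) • (fderiv ℝ (fun x => G x v) y u + fderiv ℝ (fun x => G x u) y v
      - fderiv ℝ (fun x => G x u v) y))

/-- The curvature tensor
`R(u,v)w = ∂_u(Γ(v,w)) - ∂_v(Γ(u,w)) + Γ(u,Γ(v,w)) - Γ(v,Γ(u,w))`. -/
noncomputable def curvatureTensor (G : V → V →L[ℝ] V →L[ℝ] ℝ) (y u v w : V) : V :=
  fderiv ℝ (fun x => christoffel G x v w) y u - fderiv ℝ (fun x => christoffel G x u w) y v
    + christoffel G y u (christoffel G y v w) - christoffel G y v (christoffel G y u w)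

/-- The Ricci tensor: `Ric_y(v,w)` is the trace of `u ↦ R_y(u,v)w`. -/
noncomputable def ricci (G : V → V →L[ℝ] V →L[ℝ] ℝ) (y v w : V) : ℝ :=
  ∑ i, (Module.finBasis ℝ V).coord i (curvatureTensor G y (Module.finBasis ℝ V i) v w)

/-- The scalar curvature `∑ᵢⱼ gⁱʲ Ric(bᵢ, bⱼ)`, written as `∑ᵢ Ric(bᵢ, (bⁱ)♯)` with `bⁱ` the
dual basis and `♯` the inverse of the musical map. -/
noncomputable def scalarCurvatureOn (G : V → V →L[ℝ] V →L[ℝ] ℝ) (y : V) : ℝ :=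
  ∑ i, ricci G y (Module.finBasis ℝ V i)
    (ContinuousLinearMap.inverse (G y)
      (LinearMap.toContinuousLinearMap ((Module.finBasis ℝ V).coord i)))

/-- The Riemannian density `√|det (G_y(bᵢ,bⱼ))|`, relative to the basis `b = Module.finBasis ℝ V`. -/
noncomputable def volumeDensity (G : V → V →L[ℝ] V →L[ℝ] ℝ) (y : V) : ℝ :=
  √|(Matrix.of fun i j => G y (Module.finBasis ℝ V i) (Module.finBasis ℝ V j)).det|

end Curvature

section Manifold

variable {V : Type*} [NormedAddCommGroup V] [NormedSpace ℝ V]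
  {B : Type*} [TopologicalSpace B] (I : ModelWithCorners ℝ V B)
  {M : Type*} [TopologicalSpace M] [ChartedSpace B M]

/-- The expression of a field `g` of bilinear forms on the tangent spaces of `M` in the preferred
chart `φ` at `x`: `y ↦ g(dφ⁻¹_y ·, dφ⁻¹_y ·)`. -/
noncomputable def inChart (g : ∀ p : M, TangentSpace I p →L[ℝ] TangentSpace I p →L[ℝ] ℝ)
    (x : M) (y : V) : V →L[ℝ] V →L[ℝ] ℝ :=
  let A : V →L[ℝ] V := mfderiv 𝓘(ℝ, V) I (extChartAt I x).symm y
  let b : V →L[ℝ] V →L[ℝ] ℝ := g ((extChartAt I x).symm y)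
  b.bilinearComp A A

theorem inChart_apply (g : ∀ p : M, TangentSpace I p →L[ℝ] TangentSpace I p →L[ℝ] ℝ)
    (x : M) (y u v : V) :
    inChart I g x y u v = g ((extChartAt I x).symm y)
      (mfderiv 𝓘(ℝ, V) I (extChartAt I x).symm y u)
      (mfderiv 𝓘(ℝ, V) I (extChartAt I x).symm y v) := rfl

/-- The scalar curvature of a Riemannian metric on a manifold without boundary, computed at `x` in
the preferred chart at `x`. -/
noncomputable def scalarCurvature [FiniteDimensional ℝ V]
    (g : ∀ p : M, TangentSpace I p →L[ℝ] TangentSpace I p →L[ℝ] ℝ) (x : M) : ℝ :=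
  scalarCurvatureOn (inChart I g x) (extChartAt I x x)

/-- The Riemannian measure of `g` on the domain of the preferred chart `φ` at `x`, extended by zero:
the image under `φ⁻¹` of `√(det gᵢⱼ) dy` on the target of `φ`. -/
noncomputable def chartVolume [FiniteDimensional ℝ V] [MeasurableSpace V] [BorelSpace V]
    [MeasurableSpace M]
    (g : ∀ p : M, TangentSpace I p →L[ℝ] TangentSpace I p →L[ℝ] ℝ) (x : M) : Measure M :=
  (((Module.finBasis ℝ V).addHaar.restrict (extChartAt I x).target).withDensity
    (fun y => ENNReal.ofReal (volumeDensity (inChart I g x) y))).map (extChartAt I x).symm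

/-- The Riemannian measure `dvol_g`. Its restrictions to the chart domains are the measures
`chartVolume`, and it is the least measure which dominates all of them. -/
noncomputable def riemannianVolume [FiniteDimensional ℝ V] [MeasurableSpace V] [BorelSpace V]
    [MeasurableSpace M]
    (g : ∀ p : M, TangentSpace I p →L[ℝ] TangentSpace I p →L[ℝ] ℝ) : Measure M :=
  ⨆ x : M, chartVolume I g x

/-- `f` is an isometry of the Riemannian manifold `(M, h)`: a diffeomorphism with `f^* h = h`. -/
def IsRiemannianIsometry (h : ∀ p : M, TangentSpace I p →L[ℝ] TangentSpace I p →L[ℝ] ℝ)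
    (f : M ≃ₘ^∞⟮I, I⟯ M) : Prop :=
  ∀ (p : M) (X Y : TangentSpace I p),
    h (f p) (mfderiv I I f p X) (mfderiv I I f p Y) = h p X Y

/-- A Riemannian metric on a Lie group is (left) invariant. -/
def IsLeftInvariantMetric [Group M]
    (k : ∀ z : M, TangentSpace I z →L[ℝ] TangentSpace I z →L[ℝ] ℝ) : Prop :=
  ∀ (a z : M) (v w : TangentSpace I z),
    k (a * z) (mfderiv I I (fun x => a * x) z v) (mfderiv I I (fun x => a * x) z w) = k z v w

/-- The 1-form `α` on `M` with values in the normed space `F` is smooth, as a section of the bundle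
with fibers `Hom(T_pM, F)`. -/
def IsSmoothOneForm {F : Type*} [NormedAddCommGroup F] [NormedSpace ℝ F] [IsManifold I ∞ M]
    (α : ∀ p : M, TangentSpace I p →L[ℝ] F) : Prop :=
  ContMDiff I (I.prod 𝓘(ℝ, V →L[ℝ] F)) ∞
    (fun p => TotalSpace.mk' (V →L[ℝ] F)
      (E := fun p : M => TangentSpace I p →L[ℝ] Bundle.Trivial M F p) p (α p))

end Manifold

/-! ## The metrics `g_λ` on `N × H` -/

section Bundle

variable {n r : ℕ}
  {N : Type*} [TopologicalSpace N] [ChartedSpace (EuclideanSpace ℝ (Fin n)) N]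
  {H : Type*} [TopologicalSpace H] [ChartedSpace (EuclideanSpace ℝ (Fin r)) H] [CommGroup H]

/-- The connection form on the trivial bundle `N × H` extending `lam`: the tangent vector `(X, W)`
at `(p, z)` is mapped to `lam(X) + d(z⁻¹ ·)W`, an element of the Lie algebra of `H`. -/
noncomputable def connectionForm
    (lam : ∀ p : N, TangentSpace (𝓡 n) p →L[ℝ] GroupLieAlgebra (𝓡 r) H) (q : N × H) :
    TangentSpace ((𝓡 n).prod (𝓡 r)) q →L[ℝ] GroupLieAlgebra (𝓡 r) H :=
  let trivializeLeft : TangentSpace (𝓡 r) q.2 →L[ℝ] GroupLieAlgebra (𝓡 r) H :=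
    mfderiv (𝓡 r) (𝓡 r) (fun x : H => q.2⁻¹ * x) q.2
  lam q.1 ∘L mfderiv ((𝓡 n).prod (𝓡 r)) (𝓡 n) (Prod.fst : N × H → N) q +
    trivializeLeft ∘L mfderiv ((𝓡 n).prod (𝓡 r)) (𝓡 r) (Prod.snd : N × H → H) q

/-- The metric `g_λ` on `N × H`: the Riemannian metric which induces the invariant metric `k` on the
fibers, for which the projection to `(N, h)` is a Riemannian submersion, and whose horizontal
distribution is the kernel of the connection form `ω` extending `lam`. In formulas,
`g_λ(ξ, η) = h(dπ ξ, dπ η) + ⟨ω(ξ), ω(η)⟩`, with `⟨·,·⟩` the restriction of `k` to the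
Lie algebra. -/
noncomputable def bundleMetric
    (h : ∀ p : N, TangentSpace (𝓡 n) p →L[ℝ] TangentSpace (𝓡 n) p →L[ℝ] ℝ)
    (k : ∀ z : H, TangentSpace (𝓡 r) z →L[ℝ] TangentSpace (𝓡 r) z →L[ℝ] ℝ)
    (lam : ∀ p : N, TangentSpace (𝓡 n) p →L[ℝ] GroupLieAlgebra (𝓡 r) H) (q : N × H) :
    TangentSpace ((𝓡 n).prod (𝓡 r)) q →L[ℝ] TangentSpace ((𝓡 n).prod (𝓡 r)) q →L[ℝ] ℝ :=
  let dπ : EuclideanSpace ℝ (Fin n) × EuclideanSpace ℝ (Fin r) →L[ℝ] EuclideanSpace ℝ (Fin n) :=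
    mfderiv ((𝓡 n).prod (𝓡 r)) (𝓡 n) (Prod.fst : N × H → N) q
  let om : EuclideanSpace ℝ (Fin n) × EuclideanSpace ℝ (Fin r) →L[ℝ] EuclideanSpace ℝ (Fin r) :=
    connectionForm lam q
  let hq : EuclideanSpace ℝ (Fin n) →L[ℝ] EuclideanSpace ℝ (Fin n) →L[ℝ] ℝ := h q.1
  let k1 : EuclideanSpace ℝ (Fin r) →L[ℝ] EuclideanSpace ℝ (Fin r) →L[ℝ] ℝ := k 1
  hq.bilinearComp dπ dπ + k1.bilinearComp om om

theorem bundleMetric_apply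
    (h : ∀ p : N, TangentSpace (𝓡 n) p →L[ℝ] TangentSpace (𝓡 n) p →L[ℝ] ℝ)
    (k : ∀ z : H, TangentSpace (𝓡 r) z →L[ℝ] TangentSpace (𝓡 r) z →L[ℝ] ℝ)
    (lam : ∀ p : N, TangentSpace (𝓡 n) p →L[ℝ] GroupLieAlgebra (𝓡 r) H) (q : N × H)
    (ξ η : TangentSpace ((𝓡 n).prod (𝓡 r)) q) :
    bundleMetric h k lam q ξ η =
      h q.1 (mfderiv ((𝓡 n).prod (𝓡 r)) (𝓡 n) (Prod.fst : N × H → N) q ξ)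
          (mfderiv ((𝓡 n).prod (𝓡 r)) (𝓡 n) (Prod.fst : N × H → N) q η) +
        k 1 (connectionForm lam q ξ) (connectionForm lam q η) := rfl

end Bundle

/-! By O'Neill's formula `scal^{g_λ} = scal^h - |F|² / 2`, where `dλ = F · vol_h` with
`F : N → 𝔥` (unique up to the sign of a local orientation), and the measure of `g_λ` does not
depend on `λ`. If `λ'_Z = f_Z^* λ_Z` then `⟨F', Z⟩² = ⟨F, Z⟩² ∘ f_Z`, and `f_Z` preserves the
measure and `scal^h`. Hence `∫ (scal^h)^a ⟨F, Z⟩^{2b}` is the same for `λ` and `λ'`. Its average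
over the directions `Z` is a positive constant times `∫ (scal^h)^a |F|^{2b}`, so all the moments of
`scal^{g_λ}` and `scal^{g_λ'}` agree. The moments determine the distribution of a bounded function,
and the range of a continuous function on a compact space is the support of its distribution. -/

set_option maxSynthPendingDepth 3

open Filter
open scoped Topology

/-! ## Moments -/

section Moments

theorem tendsto_integral_of_abs_sub_le {Ω : Type*} [MeasurableSpace Ω] {μ : Measure Ω}
    [IsFiniteMeasure μ] {F : ℕ → Ω → ℝ} {f : Ω → ℝ} {ε : ℕ → ℝ} (hε : Tendsto ε atTop (𝓝 0))
    (hF : ∀ m, Integrable (F m) μ) (hf : Integrable f μ)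
    (h : ∀ m, ∀ᵐ x ∂μ, |F m x - f x| ≤ ε m) :
    Tendsto (fun m => ∫ x, F m x ∂μ) atTop (𝓝 (∫ x, f x ∂μ)) := by
  refine tendsto_iff_dist_tendsto_zero.2 (squeeze_zero (fun _ => dist_nonneg) (fun m => ?_)
    (by simpa using hε.mul_const (μ.real univ)))
  rw [dist_eq_norm, ← integral_sub (hF m) hf]
  exact norm_integral_le_of_norm_le_const (h m)

theorem integrable_of_ae_mem_Icc {μ : Measure ℝ} [IsFiniteMeasure μ] {a b : ℝ}
    (hμ : ∀ᵐ x ∂μ, x ∈ Icc a b) {φ : ℝ → ℝ} (hφ : Continuous φ) : Integrable φ μ := by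
  rw [← Measure.restrict_eq_self_of_ae_mem hμ]
  exact hφ.continuousOn.integrableOn_Icc

theorem measure_eq_of_integral_pow_eq {μ ν : Measure ℝ} [IsFiniteMeasure μ] [IsFiniteMeasure ν]
    {a b : ℝ} (hμ : ∀ᵐ x ∂μ, x ∈ Icc a b) (hν : ∀ᵐ x ∂ν, x ∈ Icc a b)
    (h : ∀ j : ℕ, ∫ x, x ^ j ∂μ = ∫ x, x ^ j ∂ν) : μ = ν := by
  have hpoly (P : Polynomial ℝ) : ∫ x, P.eval x ∂μ = ∫ x, P.eval x ∂ν := by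
    simp only [Polynomial.eval_eq_sum_range]
    rw [integral_finsetSum _ fun i _ => integrable_of_ae_mem_Icc hμ (by fun_prop),
      integral_finsetSum _ fun i _ => integrable_of_ae_mem_Icc hν (by fun_prop)]
    simp only [integral_const_mul, h]
  refine ext_of_forall_integral_eq_of_IsFiniteMeasure fun φ => ?_
  choose P hP using fun m : ℕ => exists_polynomial_near_of_continuousOn a b φ
    φ.continuous.continuousOn (1 / ((m : ℝ) + 1)) (by positivity)
  have hlim (ρ : Measure ℝ) [IsFiniteMeasure ρ] (hρ : ∀ᵐ x ∂ρ, x ∈ Icc a b) :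
      Tendsto (fun m => ∫ x, (P m).eval x ∂ρ) atTop (𝓝 (∫ x, φ x ∂ρ)) :=
    tendsto_integral_of_abs_sub_le tendsto_one_div_add_atTop_nhds_zero_nat
      (fun m => integrable_of_ae_mem_Icc hρ (P m).continuous)
      (integrable_of_ae_mem_Icc hρ φ.continuous) fun m => by
        filter_upwards [hρ] with x hx using (hP m x hx).le
  refine tendsto_nhds_unique (hlim μ hμ) ?_
  simpa only [hpoly] using hlim ν hν

variable {X : Type*} [TopologicalSpace X] [CompactSpace X] [MeasurableSpace X] [BorelSpace X]
  {μ : Measure X}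

theorem range_subset_of_map_eq_map [μ.IsOpenPosMeasure] {s s' : X → ℝ} (hs : Continuous s)
    (hs' : Continuous s') (h : μ.map s = μ.map s') : range s ⊆ range s' := by
  have hopen : IsOpen (range s')ᶜ := (isCompact_range hs').isClosed.isOpen_compl
  have hnull : μ (s ⁻¹' (range s')ᶜ) = 0 := by
    rw [← Measure.map_apply hs.measurable hopen.measurableSet, h,
      Measure.map_apply hs'.measurable hopen.measurableSet, preimage_compl, preimage_range,
      compl_univ, measure_empty]
  rw [(hopen.preimage hs).measure_eq_zero_iff μ] at hnull
  rintro _ ⟨p, rfl⟩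
  by_contra hp
  exact hnull.subset hp

variable [IsFiniteMeasure μ]

theorem integrable_of_continuous_of_compactSpace {φ : X → ℝ} (hφ : Continuous φ) :
    Integrable φ μ :=
  hφ.integrable_of_hasCompactSupport (.of_compactSpace φ)

theorem map_eq_map_of_integral_pow_eq {s s' : X → ℝ} (hs : Continuous s) (hs' : Continuous s')
    (h : ∀ j : ℕ, ∫ p, s p ^ j ∂μ = ∫ p, s' p ^ j ∂μ) : μ.map s = μ.map s' := by
  obtain ⟨R, hR⟩ :=
    ((isCompact_range hs).union (isCompact_range hs')).isBounded.subset_closedBall 0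
  rw [Real.closedBall_eq_Icc] at hR
  have hbdd {u : X → ℝ} (hu : Continuous u) (hur : range u ⊆ Icc (0 - R) (0 + R)) :
      ∀ᵐ x ∂μ.map u, x ∈ Icc (0 - R) (0 + R) :=
    (ae_map_iff hu.measurable.aemeasurable measurableSet_Icc).2 <|
      .of_forall fun p => hur (mem_range_self p)
  refine measure_eq_of_integral_pow_eq (hbdd hs (subset_union_left.trans hR))
    (hbdd hs' (subset_union_right.trans hR)) fun j => ?_
  rw [integral_map hs.measurable.aemeasurable (by fun_prop),
    integral_map hs'.measurable.aemeasurable (by fun_prop), h]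

theorem range_eq_of_integral_pow_eq [μ.IsOpenPosMeasure] {s s' : X → ℝ} (hs : Continuous s)
    (hs' : Continuous s') (h : ∀ j : ℕ, ∫ p, s p ^ j ∂μ = ∫ p, s' p ^ j ∂μ) :
    range s = range s' :=
  have hmap := map_eq_map_of_integral_pow_eq hs hs' h
  (range_subset_of_map_eq_map hs hs' hmap).antisymm (range_subset_of_map_eq_map hs' hs hmap.symm)

end Moments

section DirectionalMoments

open scoped RealInnerProductSpace

variable {E : Type*} [NormedAddCommGroup E]

/-- A continuous weight, depending on the norm only, that vanishes off the unit ball: integrating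
against it averages a function of a vector over all directions. -/
noncomputable def radialWeight (c : E) : ℝ := max 0 (1 - ‖c‖)

theorem continuous_radialWeight : Continuous (radialWeight : E → ℝ) :=
  continuous_const.max (continuous_const.sub continuous_norm)

theorem radialWeight_nonneg (c : E) : 0 ≤ radialWeight c := le_max_left _ _

theorem radialWeight_eq_zero {c : E} (hc : c ∉ Metric.closedBall (0 : E) 1) :
    radialWeight c = 0 := by
  rw [mem_closedBall_zero_iff, not_le] at hc
  exact max_eq_left (by linarith)

variable [InnerProductSpace ℝ E]

theorem continuous_of_inner_sq [FiniteDimensional ℝ E] {X : Type*} [TopologicalSpace X] {w : X → E}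
    (hw : ∀ c, Continuous fun p => ⟪w p, c⟫ ^ 2) :
    Continuous fun q : X × E => ⟪w q.1, q.2⟫ ^ 2 := by
  have hprod (c d : E) : Continuous fun p => ⟪w p, c⟫ * ⟪w p, d⟫ := by
    have hpol (p : X) :
        ⟪w p, c⟫ * ⟪w p, d⟫ = (⟪w p, c + d⟫ ^ 2 - ⟪w p, c⟫ ^ 2 - ⟪w p, d⟫ ^ 2) / 2 := by
      rw [inner_add_right]
      ring
    simp only [hpol]
    exact (((hw _).sub (hw _)).sub (hw _)).div_const 2
  let e := stdOrthonormalBasis ℝ E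
  have hexp (q : X × E) :
      ⟪w q.1, q.2⟫ ^ 2 = ∑ i, ∑ j, ⟪w q.1, e i⟫ * ⟪w q.1, e j⟫ * (⟪e i, q.2⟫ * ⟪e j, q.2⟫) := by
    rw [← e.sum_inner_mul_inner, sq, Finset.sum_mul_sum]
    exact Finset.sum_congr rfl fun i _ => Finset.sum_congr rfl fun j _ => by ring
  simp only [hexp]
  exact continuous_finsetSum _ fun i _ => continuous_finsetSum _ fun j _ =>
    ((hprod _ _).comp continuous_fst).mul (by fun_prop)

theorem continuous_norm_sq_of_inner_sq [FiniteDimensional ℝ E] {X : Type*} [TopologicalSpace X]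
    {w : X → E} (hw : ∀ c, Continuous fun p => ⟪w p, c⟫ ^ 2) : Continuous fun p => ‖w p‖ ^ 2 := by
  simp only [← (stdOrthonormalBasis ℝ E).sum_sq_inner_left]
  exact continuous_finsetSum _ fun i _ => hw _

variable [FiniteDimensional ℝ E] [MeasurableSpace E] [BorelSpace E]

theorem integral_radialWeight_inner_pow_map (T : E ≃ₗᵢ[ℝ] E) (w : E) (m : ℕ) :
    ∫ c, radialWeight c * ⟪T w, c⟫ ^ m = ∫ c, radialWeight c * ⟪w, c⟫ ^ m := by
  rw [← T.measurePreserving.integral_comp T.toHomeomorph.measurableEmbedding]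
  simp [radialWeight]

theorem integral_radialWeight_inner_pow {e : E} (he : ‖e‖ = 1) (w : E) (m : ℕ) :
    ∫ c, radialWeight c * ⟪w, c⟫ ^ m = ‖w‖ ^ m * ∫ c, radialWeight c * ⟪e, c⟫ ^ m := by
  have hnorm : ‖‖w‖ • e‖ = ‖w‖ := by rw [norm_smul, he, norm_norm, mul_one]
  have hrot := integral_radialWeight_inner_pow_map
    (Submodule.reflection (ℝ ∙ (‖w‖ • e - w))ᗮ) (‖w‖ • e) m
  rw [Submodule.reflection_sub hnorm] at hrot
  rw [hrot, ← integral_const_mul]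
  congr 1 with c
  rw [real_inner_smul_left, mul_pow]
  ring

theorem integral_radialWeight_inner_pow_pos {e : E} (he : ‖e‖ = 1) (b : ℕ) :
    0 < ∫ c, radialWeight c * ⟪e, c⟫ ^ (2 * b) := by
  have hne : radialWeight ((1 / 2 : ℝ) • e) * ⟪e, (1 / 2 : ℝ) • e⟫ ^ (2 * b) ≠ 0 := by
    rw [radialWeight, inner_smul_right, real_inner_self_eq_norm_sq, norm_smul, he]
    norm_num
  refine Continuous.integral_pos_of_hasCompactSupport_nonneg_nonzero
    (continuous_radialWeight.mul (by fun_prop))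
    (HasCompactSupport.intro (isCompact_closedBall (0 : E) 1) fun c hc => ?_)
    (fun c => mul_nonneg (radialWeight_nonneg c) ((even_two_mul b).pow_nonneg _)) hne
  rw [radialWeight_eq_zero hc, zero_mul]

variable {X : Type*} [TopologicalSpace X] [R1Space X] [CompactSpace X] [MeasurableSpace X]
  [BorelSpace X] {μ : Measure X} [IsFiniteMeasure μ]

theorem integral_mul_norm_pow_average {φ : X → ℝ} (hφ : Continuous φ)
    {w : X → E} (hw : ∀ c, Continuous fun p => ⟪w p, c⟫ ^ 2) {e : E} (he : ‖e‖ = 1) (b : ℕ) :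
    (∫ p, φ p * (‖w p‖ ^ 2) ^ b ∂μ) * ∫ c, radialWeight c * ⟪e, c⟫ ^ (2 * b) =
      ∫ c, radialWeight c * ∫ p, φ p * (⟪w p, c⟫ ^ 2) ^ b ∂μ := by
  have hpoint (p : X) : φ p * (‖w p‖ ^ 2) ^ b * ∫ c, radialWeight c * ⟪e, c⟫ ^ (2 * b) =
      ∫ c, radialWeight c * (φ p * (⟪w p, c⟫ ^ 2) ^ b) := by
    simp only [← pow_mul]
    rw [mul_assoc, ← integral_radialWeight_inner_pow he, ← integral_const_mul]
    simp only [mul_left_comm]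
  rw [← integral_mul_const]
  simp only [hpoint]
  simp only [← integral_const_mul]
  refine integral_integral_swap_of_hasCompactSupport
    (f := fun p c => radialWeight c * (φ p * (⟪w p, c⟫ ^ 2) ^ b)) ?_ ?_
  · exact (continuous_radialWeight.comp continuous_snd).mul
      ((hφ.comp continuous_fst).mul ((continuous_of_inner_sq hw).pow b))
  · refine HasCompactSupport.intro (isCompact_univ.prod (isCompact_closedBall (0 : E) 1))
      fun q hq => mul_eq_zero_of_left (radialWeight_eq_zero fun hball => hq ⟨mem_univ _, hball⟩) _

theorem integral_pow_mul_norm_pow_eq {K : X → ℝ} (hK : Continuous K)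
    {w w' : X → E} (hw : ∀ c, Continuous fun p => ⟪w p, c⟫ ^ 2)
    (hw' : ∀ c, Continuous fun p => ⟪w' p, c⟫ ^ 2)
    (hF : ∀ c, ∃ F : X → X, MeasurePreserving F μ μ ∧ (∀ p, K (F p) = K p) ∧
      ∀ p, ⟪w' p, c⟫ ^ 2 = ⟪w (F p), c⟫ ^ 2) (a b : ℕ) :
    ∫ p, K p ^ a * (‖w p‖ ^ 2) ^ b ∂μ = ∫ p, K p ^ a * (‖w' p‖ ^ 2) ^ b ∂μ := by
  rcases subsingleton_or_nontrivial E with hE | hE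
  · rw [Subsingleton.elim w w']
  obtain ⟨e, he⟩ := exists_norm_eq E zero_le_one
  refine mul_right_cancel₀ (integral_radialWeight_inner_pow_pos he b).ne' ?_
  rw [integral_mul_norm_pow_average (φ := fun p => K p ^ a) (hK.pow a) hw he,
    integral_mul_norm_pow_average (φ := fun p => K p ^ a) (hK.pow a) hw' he]
  congr 1 with c
  congr 1
  obtain ⟨F, hFμ, hFK, hFw⟩ := hF c
  have hmap := integral_map (μ := μ) hFμ.measurable.aemeasurable
    (((hK.pow a).mul ((hw c).pow b)).aestronglyMeasurable)
  rw [hFμ.map_eq] at hmap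
  simpa only [Pi.mul_apply, Pi.pow_apply, hFK, hFw] using hmap

theorem integral_sub_norm_sq_pow_eq {K : X → ℝ} (hK : Continuous K)
    {w w' : X → E} (hw : ∀ c, Continuous fun p => ⟪w p, c⟫ ^ 2)
    (hw' : ∀ c, Continuous fun p => ⟪w' p, c⟫ ^ 2)
    (hF : ∀ c, ∃ F : X → X, MeasurePreserving F μ μ ∧ (∀ p, K (F p) = K p) ∧
      ∀ p, ⟪w' p, c⟫ ^ 2 = ⟪w (F p), c⟫ ^ 2) (t : ℝ) (j : ℕ) :
    ∫ p, (K p - t * ‖w p‖ ^ 2) ^ j ∂μ = ∫ p, (K p - t * ‖w' p‖ ^ 2) ^ j ∂μ := by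
  have hexpand {w : X → E} (hw : ∀ c, Continuous fun p => ⟪w p, c⟫ ^ 2) :
      ∫ p, (K p - t * ‖w p‖ ^ 2) ^ j ∂μ = ∑ a ∈ Finset.range (j + 1),
        ((-t) ^ (j - a) * (j.choose a : ℝ)) * ∫ p, K p ^ a * (‖w p‖ ^ 2) ^ (j - a) ∂μ := by
    simp only [← integral_const_mul]
    rw [← integral_finsetSum]
    · congr 1 with p
      rw [sub_eq_add_neg, ← neg_mul, add_pow]
      exact Finset.sum_congr rfl fun a _ => by rw [mul_pow]; ring
    · exact fun a _ => integrable_of_continuous_of_compactSpace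
        (continuous_const.mul ((hK.pow a).mul ((continuous_norm_sq_of_inner_sq hw).pow _)))
  rw [hexpand hw, hexpand hw']
  simp only [integral_pow_mul_norm_pow_eq hK hw hw' hF]

end DirectionalMoments

/-! ## Curvature of metrics on a vector space -/

section Calculus

variable {D E F : Type*} [NormedAddCommGroup D] [NormedSpace ℝ D] [NormedAddCommGroup E]
  [NormedSpace ℝ E] [NormedAddCommGroup F] [NormedSpace ℝ F]

theorem contDiffAt_of_clm_apply [FiniteDimensional ℝ E] {n : WithTop ℕ∞} {f : D → E →L[ℝ] F}
    {x : D} (hf : ∀ e, ContDiffAt ℝ n (fun y => f y e) x) : ContDiffAt ℝ n f x := by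
  have hd : Module.finrank ℝ E = Module.finrank ℝ (Fin (Module.finrank ℝ E) → ℝ) :=
    (Module.finrank_fin_fun ℝ).symm
  let φ := ((ContinuousLinearEquiv.ofFinrankEq hd).arrowCongr (1 : F ≃L[ℝ] F)).trans
    (ContinuousLinearEquiv.piRing (Fin (Module.finrank ℝ E)))
  rw [← Function.id_comp f, ← φ.symm_comp_self]
  exact φ.symm.contDiff.contDiffAt.comp x (contDiffAt_pi.mpr fun i => hf _)

theorem fderiv_clm_apply_const {f : D → E →L[ℝ] F} {y : D} (hf : DifferentiableAt ℝ f y)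
    (e : E) (u : D) : fderiv ℝ (fun x => f x e) y u = fderiv ℝ f y u e := by
  rw [fderiv_clm_apply hf (by fun_prop)]
  simp

theorem fderiv_clm_apply_const₂ {f : D → E →L[ℝ] E →L[ℝ] F} {y : D} (hf : DifferentiableAt ℝ f y)
    (a b : E) (u : D) : fderiv ℝ (fun x => f x a b) y u = fderiv ℝ f y u a b := by
  rw [fderiv_clm_apply_const (by fun_prop), fderiv_clm_apply_const hf]

theorem isSymmSndFDerivAt_of_contDiffAt_infty {f : D → F} {y : D} (hf : ContDiffAt ℝ ∞ f y) :
    IsSymmSndFDerivAt ℝ f y :=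
  hf.isSymmSndFDerivAt <| by
    rw [minSmoothness_of_isRCLikeNormedField]
    exact WithTop.coe_le_coe.2 le_top

variable [FiniteDimensional ℝ D] {g : D → E →L[ℝ] E →L[ℝ] ℝ} {P : D → D →L[ℝ] E} {y : D}

theorem contDiffAt_bilinearComp (hg : ContDiffAt ℝ ∞ g y) (hP : ContDiffAt ℝ ∞ P y) :
    ContDiffAt ℝ ∞ (fun x => (g x).bilinearComp (P x) (P x)) y := by
  refine contDiffAt_of_clm_apply fun a => contDiffAt_of_clm_apply fun b => ?_
  simp only [ContinuousLinearMap.bilinearComp_apply]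
  fun_prop

theorem fderiv_bilinearComp (hg : ContDiffAt ℝ ∞ g y) (hP : ContDiffAt ℝ ∞ P y) (u a b : D) :
    fderiv ℝ (fun x => (g x).bilinearComp (P x) (P x)) y u a b =
      fderiv ℝ g y u (P y a) (P y b) + g y (fderiv ℝ P y u a) (P y b)
        + g y (P y a) (fderiv ℝ P y u b) := by
  have hg' := hg.differentiableAt (by simp)
  have hP' := hP.differentiableAt (by simp)
  rw [← fderiv_clm_apply_const₂ ((contDiffAt_bilinearComp hg hP).differentiableAt (by simp))]
  simp only [ContinuousLinearMap.bilinearComp_apply]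
  rw [fderiv_clm_apply (by fun_prop) (by fun_prop),
    fderiv_clm_apply (c := g) (u := fun x => P x a) (by fun_prop) (by fun_prop)]
  simp only [add_apply, ContinuousLinearMap.comp_apply, ContinuousLinearMap.flip_apply,
    fderiv_clm_apply_const hP']
  ring

end Calculus

section ScalarProduct

variable {V : Type*} [AddCommGroup V] [Module ℝ V]

theorem sum_coord_apply_eq_sum_coord_apply {ι κ : Type*} [Fintype ι] [Fintype κ]
    (b : Module.Basis ι ℝ V) (e : Module.Basis κ ℝ V) (T : V →ₗ[ℝ] V) :
    ∑ i, b.coord i (T (b i)) = ∑ k, e.coord k (T (e k)) := by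
  classical
  have htrace := (LinearMap.trace_eq_matrix_trace ℝ b T).symm.trans
    (LinearMap.trace_eq_matrix_trace ℝ e T)
  simpa [Matrix.trace, LinearMap.toMatrix_apply] using htrace

theorem coord_eq_apply_of_orthonormal {κ : Type*} [Finite κ] [DecidableEq κ]
    {b : V →ₗ[ℝ] V →ₗ[ℝ] ℝ} {e : Module.Basis κ ℝ V}
    (he : ∀ i j, b (e i) (e j) = if i = j then 1 else 0) (k : κ) (x : V) :
    e.coord k x = b x (e k) := by
  have := Fintype.ofFinite κ
  conv_rhs => rw [← e.sum_repr x]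
  simp [he, -Module.Basis.sum_repr]

theorem exists_basis_orthonormal_of_pos [FiniteDimensional ℝ V] {b : V →ₗ[ℝ] V →ₗ[ℝ] ℝ}
    (hsymm : ∀ u v, b u v = b v u) (hpos : ∀ v, v ≠ 0 → 0 < b v v) {n : ℕ}
    (hn : Module.finrank ℝ V = n) :
    ∃ e : Module.Basis (Fin n) ℝ V, ∀ i j, b (e i) (e j) = if i = j then 1 else 0 := by
  let core : InnerProductSpace.Core ℝ V :=
    { inner := fun u v => b u v
      conj_inner_symm := fun u v => by simp [hsymm u v]
      re_inner_nonneg := fun u => by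
        by_cases hu : u = 0
        · simp [hu]
        · exact (hpos u hu).le
      add_left := fun u v w => by simp
      smul_left := fun u v r => by simp
      definite := fun u hu => by
        by_contra hne
        exact (hpos u hne).ne' hu }
  let _ : NormedAddCommGroup V := core.toNormedAddCommGroup
  let _ : InnerProductSpace ℝ V := InnerProductSpace.ofCore core.toCore
  let o := (stdOrthonormalBasis ℝ V).reindex (finCongr hn)
  refine ⟨o.toBasis, fun i j => ?_⟩
  rw [OrthonormalBasis.coe_toBasis]
  exact orthonormal_iff_ite.1 o.orthonormal i j

end ScalarProduct

section LeviCivita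

variable {V : Type*} [NormedAddCommGroup V] [NormedSpace ℝ V]

theorem isInvertible_of_pos [FiniteDimensional ℝ V] {b : V →L[ℝ] V →L[ℝ] ℝ}
    (hpos : ∀ v, v ≠ 0 → 0 < b v v) : b.IsInvertible := by
  have hinj : Function.Injective (b : V →ₗ[ℝ] (V →L[ℝ] ℝ)) := by
    rw [← LinearMap.ker_eq_bot, LinearMap.ker_eq_bot']
    intro v (hv : b v = 0)
    by_contra hne
    simpa [hv] using hpos v hne
  have hdim : Module.finrank ℝ V = Module.finrank ℝ (V →L[ℝ] ℝ) := by
    rw [← LinearEquiv.finrank_eq (LinearMap.toContinuousLinearMap (𝕜 := ℝ) (E := V) (F' := ℝ))]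
    exact (Subspace.dual_finrank_eq (K := ℝ) (V := V)).symm
  exact ⟨(LinearMap.linearEquivOfInjective _ hinj hdim).toContinuousLinearEquiv, by ext; rfl⟩

/-- The Koszul expression `(D(u,v,w) + D(v,u,w) - D(w,u,v)) / 2` of a trilinear form `D`; for
`D = DG` it is `G(Γ(u,v), w)`, with `Γ` the Levi-Civita connection of `G`. -/
noncomputable def koszul : (V →L[ℝ] V →L[ℝ] V →L[ℝ] ℝ) →L[ℝ] (V →L[ℝ] V →L[ℝ] V →L[ℝ] ℝ) :=
  let σ := (ContinuousLinearMap.flipₗᵢ ℝ V V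
    (V →L[ℝ] ℝ)).toContinuousLinearEquiv.toContinuousLinearMap
  let τ := ContinuousLinearMap.compL ℝ V (V →L[ℝ] V →L[ℝ] ℝ) (V →L[ℝ] V →L[ℝ] ℝ)
    (ContinuousLinearMap.flipₗᵢ ℝ V V ℝ).toContinuousLinearEquiv.toContinuousLinearMap
  (1 / 2 : ℝ) • (ContinuousLinearMap.id ℝ _ + σ - τ ∘L σ)

theorem koszul_apply (D : V →L[ℝ] V →L[ℝ] V →L[ℝ] ℝ) (u v w : V) :
    koszul D u v w = 1 / 2 * (D u v w + D v u w - D w u v) := by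
  simp [koszul]

/-- The Christoffel map, bundled as a field of bilinear maps. -/
noncomputable def christoffelMap (G : V → V →L[ℝ] V →L[ℝ] ℝ) (y : V) : V →L[ℝ] V →L[ℝ] V :=
  ContinuousLinearMap.compL ℝ V (V →L[ℝ] ℝ) V (ContinuousLinearMap.inverse (G y)) ∘L
    koszul (fderiv ℝ G y)

/-- `G` is a Riemannian metric at `y`: it is smooth at `y`, and `G y` is a scalar product. -/
structure IsMetricPoint (G : V → V →L[ℝ] V →L[ℝ] ℝ) (y : V) : Prop where
  smooth : ContDiffAt ℝ ∞ G y
  symm : ∀ u v, G y u v = G y v u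
  pos : ∀ v, v ≠ 0 → 0 < G y v v

namespace IsMetricPoint

variable {G G' : V → V →L[ℝ] V →L[ℝ] ℝ} {y : V}

theorem congr (hG : IsMetricPoint G y) (h : G' =ᶠ[𝓝 y] G) : IsMetricPoint G' y where
  smooth := hG.smooth.congr_of_eventuallyEq h
  symm u v := by rw [h.self_of_nhds]; exact hG.symm u v
  pos v hv := by rw [h.self_of_nhds]; exact hG.pos v hv

theorem differentiableAt (hG : IsMetricPoint G y) : DifferentiableAt ℝ G y :=
  hG.smooth.differentiableAt (by simp)

theorem ext_of_apply (hG : IsMetricPoint G y) {a b : V} (h : ∀ w, G y a w = G y b w) : a = b := by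
  by_contra hne
  have := hG.pos (a - b) (sub_ne_zero.2 hne)
  simp [h] at this

theorem christoffelMap_apply (hG : IsMetricPoint G y) (u v : V) :
    christoffelMap G y u v = christoffel G y u v := by
  have hd := hG.differentiableAt
  simp only [christoffel, christoffelMap, ContinuousLinearMap.comp_apply,
    ContinuousLinearMap.compL_apply]
  congr 1
  ext w
  have hderiv (a b : V) : fderiv ℝ (fun x => G x a) y b w = fderiv ℝ G y b a w := by
    rw [fderiv_clm_apply_const hd]
  simp [koszul_apply, hderiv, fderiv_clm_apply_const₂ hd]

theorem exists_basis_orthonormal [FiniteDimensional ℝ V] (hG : IsMetricPoint G y) {n : ℕ}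
    (hn : Module.finrank ℝ V = n) :
    ∃ e : Module.Basis (Fin n) ℝ V, ∀ i j, G y (e i) (e j) = if i = j then 1 else 0 :=
  exists_basis_orthonormal_of_pos (b := ContinuousLinearMap.toLinearMap₁₂ (G y)) hG.symm hG.pos hn

theorem coord_eq_apply (y : V) {κ : Type*} [Finite κ] [DecidableEq κ]
    {e : Module.Basis κ ℝ V} (he : ∀ i j, G y (e i) (e j) = if i = j then 1 else 0)
    (k : κ) (x : V) : e.coord k x = G y x (e k) :=
  coord_eq_apply_of_orthonormal (b := ContinuousLinearMap.toLinearMap₁₂ (G y)) he k x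

variable [FiniteDimensional ℝ V]

theorem apply_inverse (hG : IsMetricPoint G y) (l : V →L[ℝ] ℝ) (w : V) :
    G y (ContinuousLinearMap.inverse (G y) l) w = l w := by
  obtain ⟨e, he⟩ := isInvertible_of_pos hG.pos
  rw [← he]
  simp

theorem contDiffAt_inverse (hG : IsMetricPoint G y) :
    ContDiffAt ℝ ∞ (fun x => ContinuousLinearMap.inverse (G x)) y := by
  obtain ⟨e, he⟩ := isInvertible_of_pos hG.pos
  have he_inv := contDiffAt_map_inverse (n := ∞) e
  rw [he] at he_inv
  exact he_inv.comp y hG.smooth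

theorem contDiffAt_christoffelMap (hG : IsMetricPoint G y) :
    ContDiffAt ℝ ∞ (christoffelMap G) y := by
  have hkoszul : ContDiffAt ℝ ∞ (fun x => koszul (fderiv ℝ G x)) y :=
    (koszul (V := V)).contDiff.contDiffAt.comp y (hG.smooth.fderiv_right (by simp))
  exact ((ContinuousLinearMap.compL ℝ V (V →L[ℝ] ℝ) V).contDiff.contDiffAt.comp y
    hG.contDiffAt_inverse).clm_comp hkoszul

theorem differentiableAt_christoffelMap (hG : IsMetricPoint G y) :
    DifferentiableAt ℝ (christoffelMap G) y :=
  hG.contDiffAt_christoffelMap.differentiableAt (by simp)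

theorem apply_christoffelMap (hG : IsMetricPoint G y) (u v w : V) :
    G y (christoffelMap G y u v) w =
      1 / 2 * (fderiv ℝ G y u v w + fderiv ℝ G y v u w - fderiv ℝ G y w u v) := by
  rw [← koszul_apply]
  exact hG.apply_inverse _ _

theorem sum_apply_inverse_coord (hG : IsMetricPoint G y) {ι κ : Type*} [Fintype ι] [Fintype κ]
    [DecidableEq κ] (b : Module.Basis ι ℝ V) {e : Module.Basis κ ℝ V}
    (he : ∀ i j, G y (e i) (e j) = if i = j then 1 else 0) (Q : V →L[ℝ] V →L[ℝ] ℝ) :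
    ∑ i, Q (b i) (ContinuousLinearMap.inverse (G y) (LinearMap.toContinuousLinearMap (b.coord i))) =
      ∑ j, Q (e j) (e j) := by
  let S : V →ₗ[ℝ] V := ContinuousLinearMap.inverse (G y) ∘L Q
  have hS (v w : V) : G y (S v) w = Q v w := hG.apply_inverse (Q v) w
  have hQ (v : V) (l : V →L[ℝ] ℝ) : Q v (ContinuousLinearMap.inverse (G y) l) = l (S v) := by
    rw [← hS, hG.symm, hG.apply_inverse]
  simp only [hQ, LinearMap.coe_toContinuousLinearMap']
  rw [sum_coord_apply_eq_sum_coord_apply b e S]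
  simp only [coord_eq_apply y he, hS]

end IsMetricPoint

theorem christoffelMap_congr {G G' : V → V →L[ℝ] V →L[ℝ] ℝ} {y : V} (h : G =ᶠ[𝓝 y] G') :
    christoffelMap G =ᶠ[𝓝 y] christoffelMap G' := by
  filter_upwards [h.eventuallyEq_nhds] with x hx
  rw [christoffelMap, christoffelMap, hx.fderiv_eq, hx.self_of_nhds]

/-- The curvature tensor `(u, v, w) ↦ R(u,v)w` of the connection with Christoffel map `Γ`. -/
noncomputable def connectionCurvature (Γ : V → V →L[ℝ] V →L[ℝ] V) (y : V) :
    V →L[ℝ] V →L[ℝ] V →L[ℝ] V :=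
  let D := fderiv ℝ Γ y + (ContinuousLinearMap.compL ℝ V V V).bilinearComp (Γ y) (Γ y)
  D - D.flip

theorem connectionCurvature_apply (Γ : V → V →L[ℝ] V →L[ℝ] V) (y u v w : V) :
    connectionCurvature Γ y u v w = fderiv ℝ Γ y u v w - fderiv ℝ Γ y v u w
      + Γ y u (Γ y v w) - Γ y v (Γ y u w) := by
  simp only [connectionCurvature, sub_apply, add_apply, ContinuousLinearMap.bilinearComp_apply,
    ContinuousLinearMap.compL_apply, ContinuousLinearMap.comp_apply,
    ContinuousLinearMap.flip_apply]
  abel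

variable [FiniteDimensional ℝ V] {G G' : V → V →L[ℝ] V →L[ℝ] ℝ} {y : V}

theorem curvatureTensor_eq_connectionCurvature (hG : ∀ᶠ x in 𝓝 y, IsMetricPoint G x) (u v w : V) :
    curvatureTensor G y u v w = connectionCurvature (christoffelMap G) y u v w := by
  have hGy := hG.self_of_nhds
  have hderiv (a v w : V) : fderiv ℝ (fun x => christoffel G x v w) y a =
      fderiv ℝ (christoffelMap G) y a v w := by
    rw [← fderiv_clm_apply_const₂ hGy.differentiableAt_christoffelMap]
    congr 1
    apply EventuallyEq.fderiv_eq
    filter_upwards [hG] with x hx using (hx.christoffelMap_apply v w).symm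
  simp only [curvatureTensor, connectionCurvature_apply, hderiv, hGy.christoffelMap_apply]

theorem ricci_eq_sum (hG : ∀ᶠ x in 𝓝 y, IsMetricPoint G x) {κ : Type*} [Fintype κ] [DecidableEq κ]
    {e : Module.Basis κ ℝ V} (he : ∀ i j, G y (e i) (e j) = if i = j then 1 else 0) (v w : V) :
    ricci G y v w = ∑ k, G y (connectionCurvature (christoffelMap G) y (e k) v w) (e k) := by
  let T : V →ₗ[ℝ] V :=
    (ContinuousLinearMap.apply ℝ V w) ∘L ((connectionCurvature (christoffelMap G) y).flip v)
  have hT := sum_coord_apply_eq_sum_coord_apply (Module.finBasis ℝ V) e T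
  simp only [IsMetricPoint.coord_eq_apply y he] at hT
  simp only [ricci, curvatureTensor_eq_connectionCurvature hG]
  exact hT

theorem scalarCurvatureOn_eq_sum (hG : ∀ᶠ x in 𝓝 y, IsMetricPoint G x) {κ : Type*} [Fintype κ]
    [DecidableEq κ] {e : Module.Basis κ ℝ V}
    (he : ∀ i j, G y (e i) (e j) = if i = j then 1 else 0) :
    scalarCurvatureOn G y =
      ∑ j, ∑ i, G y (connectionCurvature (christoffelMap G) y (e i) (e j) (e j)) (e i) := by
  let Q : V →L[ℝ] V →L[ℝ] ℝ := ∑ k, ContinuousLinearMap.compL ℝ V V ℝ ((G y).flip (e k)) ∘L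
    connectionCurvature (christoffelMap G) y (e k)
  have hQ (v w : V) : Q v w =
      ∑ k, G y (connectionCurvature (christoffelMap G) y (e k) v w) (e k) := by
    simp [Q, sum_apply]
  simp only [scalarCurvatureOn, ricci_eq_sum hG he, ← hQ]
  exact hG.self_of_nhds.sum_apply_inverse_coord _ he Q

theorem scalarCurvatureOn_congr (h : G =ᶠ[𝓝 y] G') (hG : ∀ᶠ x in 𝓝 y, IsMetricPoint G x) :
    scalarCurvatureOn G y = scalarCurvatureOn G' y := by
  have hG' : ∀ᶠ x in 𝓝 y, IsMetricPoint G' x := by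
    filter_upwards [hG, h.symm.eventuallyEq_nhds] with x hx hx' using hx.congr hx'
  obtain ⟨e, he⟩ := hG.self_of_nhds.exists_basis_orthonormal rfl
  rw [scalarCurvatureOn_eq_sum hG he,
    scalarCurvatureOn_eq_sum hG' (by rw [← h.self_of_nhds]; exact he)]
  simp only [connectionCurvature, (christoffelMap_congr h).fderiv_eq,
    (christoffelMap_congr h).self_of_nhds, h.self_of_nhds]

end LeviCivita

section MovingFrame

variable {V S : Type*} [NormedAddCommGroup V] [NormedSpace ℝ V]
  [NormedAddCommGroup S] [NormedSpace ℝ S]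

section Gauge

variable {Γ : V → V →L[ℝ] V →L[ℝ] V} {P : V → V →L[ℝ] S} {A : V → V → S →L[ℝ] S} {y : V}

theorem apply_fderiv_connection_of_gauge (hΓ : DifferentiableAt ℝ Γ y) (hP : ContDiffAt ℝ ∞ P y)
    (hA : ∀ v, DifferentiableAt ℝ (fun x => A x v) y)
    (hgauge : ∀ᶠ x in 𝓝 y, ∀ v w, P x (Γ x v w) = fderiv ℝ P x v w + A x v (P x w)) (u v w : V) :
    P y (fderiv ℝ Γ y u v w) = fderiv ℝ (fderiv ℝ P) y u v w
      + fderiv ℝ (fun x => A x v) y u (P y w) + A y v (fderiv ℝ P y u w)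
      - fderiv ℝ P y u (Γ y v w) := by
  have hP' : DifferentiableAt ℝ P y := hP.differentiableAt (by simp)
  have hP'' : DifferentiableAt ℝ (fderiv ℝ P) y :=
    (hP.fderiv_right (m := ∞) (by simp)).differentiableAt (by simp)
  have hAv := hA v
  have hderiv : fderiv ℝ (fun x => P x (Γ x v w)) y u =
      fderiv ℝ (fun x => fderiv ℝ P x v w + A x v (P x w)) y u := by
    rw [EventuallyEq.fderiv_eq]
    filter_upwards [hgauge] with x hx using hx v w
  rw [fderiv_clm_apply hP' (by fun_prop),
    fderiv_fun_add (by fun_prop) (hAv.clm_apply (by fun_prop)), fderiv_clm_apply hAv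
      (by fun_prop)] at hderiv
  simp only [add_apply, ContinuousLinearMap.comp_apply, ContinuousLinearMap.flip_apply,
    fderiv_clm_apply_const hP', fderiv_clm_apply_const₂ hΓ, fderiv_clm_apply_const₂ hP''] at hderiv
  rw [eq_sub_iff_add_eq, hderiv]
  abel

/-- Curvature in a moving frame `P`, in which the connection `Γ` has the connection form `A`. -/
theorem apply_connectionCurvature_of_gauge (hΓ : DifferentiableAt ℝ Γ y) (hP : ContDiffAt ℝ ∞ P y)
    (hA : ∀ v, DifferentiableAt ℝ (fun x => A x v) y)
    (hgauge : ∀ᶠ x in 𝓝 y, ∀ v w, P x (Γ x v w) = fderiv ℝ P x v w + A x v (P x w)) (u v w : V) :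
    P y (connectionCurvature Γ y u v w) =
      fderiv ℝ (fun x => A x v) y u (P y w) - fderiv ℝ (fun x => A x u) y v (P y w)
        + A y u (A y v (P y w)) - A y v (A y u (P y w)) := by
  simp only [connectionCurvature_apply, map_add, map_sub,
    apply_fderiv_connection_of_gauge hΓ hP hA hgauge, hgauge.self_of_nhds,
    (isSymmSndFDerivAt_of_contDiffAt_infty hP).eq u v]
  abel

end Gauge

section Pullback

variable [FiniteDimensional ℝ V] {g : V → S →L[ℝ] S →L[ℝ] ℝ} {P : V → V →L[ℝ] S} {y : V}

theorem IsMetricPoint.bilinearComp (hg : ContDiffAt ℝ ∞ g y) (hP : ContDiffAt ℝ ∞ P y)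
    (hsymm : ∀ a b, g y a b = g y b a) (hpos : ∀ a, a ≠ 0 → 0 < g y a a)
    (hinj : Function.Injective (P y)) :
    IsMetricPoint (fun x => (g x).bilinearComp (P x) (P x)) y where
  smooth := contDiffAt_bilinearComp hg hP
  symm u v := by simp [hsymm (P y u)]
  pos v hv := hpos _ fun hPv => hv (hinj (by simpa using hPv))

theorem apply_christoffelMap_bilinearComp (hg : ContDiffAt ℝ ∞ g y) (hP : ContDiffAt ℝ ∞ P y)
    (hsymm : ∀ a b, g y a b = g y b a) (hpos : ∀ a, a ≠ 0 → 0 < g y a a)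
    (hinj : Function.Injective (P y)) (u v w : V) :
    g y (P y (christoffelMap (fun x => (g x).bilinearComp (P x) (P x)) y u v)) (P y w) =
      1 / 2 * (fderiv ℝ g y u (P y v) (P y w) + fderiv ℝ g y v (P y u) (P y w)
          - fderiv ℝ g y w (P y u) (P y v))
        + 1 / 2 * (g y (fderiv ℝ P y u v + fderiv ℝ P y v u) (P y w)
          + g y (P y v) (fderiv ℝ P y u w - fderiv ℝ P y w u)
          + g y (P y u) (fderiv ℝ P y v w - fderiv ℝ P y w v)) := by
  have hΓ := (IsMetricPoint.bilinearComp hg hP hsymm hpos hinj).apply_christoffelMap u v w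
  simp only [fderiv_bilinearComp hg hP, ContinuousLinearMap.bilinearComp_apply] at hΓ
  rw [hΓ]
  simp only [map_add, map_sub, add_apply]
  rw [hsymm (fderiv ℝ P y w u) (P y v)]
  ring

end Pullback

end MovingFrame

section Isometry

variable {V : Type*} [NormedAddCommGroup V] [NormedSpace ℝ V] {Φ : V → V}

/-- The pullback `Φ^* G` of a field of bilinear forms. -/
noncomputable def formPullback (Φ : V → V) (G : V → V →L[ℝ] V →L[ℝ] ℝ) (x : V) :
    V →L[ℝ] V →L[ℝ] ℝ :=
  (G (Φ x)).bilinearComp (fderiv ℝ Φ x) (fderiv ℝ Φ x)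

variable [FiniteDimensional ℝ V] {G : V → V →L[ℝ] V →L[ℝ] ℝ} {y : V}

theorem IsMetricPoint.formPullback (hG : IsMetricPoint G (Φ y)) (hΦ : ContDiffAt ℝ ∞ Φ y)
    (hinj : Function.Injective (fderiv ℝ Φ y)) : IsMetricPoint (formPullback Φ G) y :=
  bilinearComp (hG.smooth.comp y hΦ) (hΦ.fderiv_right (by simp)) hG.symm hG.pos hinj

theorem fderiv_christoffelMap_formPullback (hG : IsMetricPoint G (Φ y))
    (hΦ : ContDiffAt ℝ ∞ Φ y) (hinj : Function.Injective (fderiv ℝ Φ y)) (v w : V) :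
    fderiv ℝ Φ y (christoffelMap (formPullback Φ G) y v w) = fderiv ℝ (fderiv ℝ Φ) y v w
      + christoffelMap G (Φ y) (fderiv ℝ Φ y v) (fderiv ℝ Φ y w) := by
  have hsurj : Function.Surjective (fderiv ℝ Φ y) :=
    LinearMap.injective_iff_surjective (f := (fderiv ℝ Φ y : V →ₗ[ℝ] V)).1 hinj
  refine hG.ext_of_apply fun z' => ?_
  obtain ⟨z, rfl⟩ := hsurj z'
  have hsymm := (isSymmSndFDerivAt_of_contDiffAt_infty hΦ).eq
  have hchain (a : V) : fderiv ℝ (fun x => G (Φ x)) y a = fderiv ℝ G (Φ y) (fderiv ℝ Φ y a) := by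
    rw [fderiv_fun_comp y hG.differentiableAt (hΦ.differentiableAt (by simp))]
    rfl
  have hΓ := apply_christoffelMap_bilinearComp (g := fun x => G (Φ x)) (hG.smooth.comp y hΦ)
    (hΦ.fderiv_right (by simp)) hG.symm hG.pos hinj v w z
  refine hΓ.trans ?_
  rw [map_add, map_add, add_apply, add_apply, hG.apply_christoffelMap, hsymm w v, hsymm z v,
    hsymm z w, hchain, hchain, hchain, sub_self, sub_self, map_zero, map_zero]
  ring

variable (hG : ∀ᶠ x in 𝓝 (Φ y), IsMetricPoint G x) (hΦ : ∀ᶠ x in 𝓝 y, ContDiffAt ℝ ∞ Φ x)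
  (hinj : ∀ᶠ x in 𝓝 y, Function.Injective (fderiv ℝ Φ x))

include hG hΦ hinj

theorem eventually_isMetricPoint_formPullback :
    ∀ᶠ x in 𝓝 y, IsMetricPoint (formPullback Φ G) x := by
  filter_upwards [hΦ, hΦ.self_of_nhds.continuousAt.eventually hG, hinj] with x hΦx hGx hinjx
  exact hGx.formPullback hΦx hinjx

theorem fderiv_connectionCurvature_formPullback (u v w : V) :
    fderiv ℝ Φ y (connectionCurvature (christoffelMap (formPullback Φ G)) y u v w) =
      connectionCurvature (christoffelMap G) (Φ y) (fderiv ℝ Φ y u) (fderiv ℝ Φ y v)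
        (fderiv ℝ Φ y w) := by
  have hΦy := hΦ.self_of_nhds
  have hDΦ : ContDiffAt ℝ ∞ (fderiv ℝ Φ) y := hΦy.fderiv_right (by simp)
  have hΦd : DifferentiableAt ℝ Φ y := hΦy.differentiableAt (by simp)
  have hDΦd : DifferentiableAt ℝ (fderiv ℝ Φ) y := hDΦ.differentiableAt (by simp)
  have hΓ := hG.self_of_nhds.differentiableAt_christoffelMap
  have hΓΦ : DifferentiableAt ℝ (fun x => christoffelMap G (Φ x)) y := hΓ.comp y hΦd
  have hgauge : ∀ᶠ x in 𝓝 y, ∀ v w, fderiv ℝ Φ x (christoffelMap (formPullback Φ G) x v w) =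
      fderiv ℝ (fderiv ℝ Φ) x v w
        + christoffelMap G (Φ x) (fderiv ℝ Φ x v) (fderiv ℝ Φ x w) := by
    filter_upwards [hΦ, hΦy.continuousAt.eventually hG, hinj] with x hΦx hGx hinjx
    exact fderiv_christoffelMap_formPullback hGx hΦx hinjx
  have hderiv (u v : V) : fderiv ℝ (fun x => christoffelMap G (Φ x) (fderiv ℝ Φ x v)) y u =
      fderiv ℝ (christoffelMap G) (Φ y) (fderiv ℝ Φ y u) (fderiv ℝ Φ y v)
        + christoffelMap G (Φ y) (fderiv ℝ (fderiv ℝ Φ) y u v) := by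
    rw [fderiv_clm_apply hΓΦ (by fun_prop), fderiv_fun_comp y hΓ hΦd]
    simp only [add_apply, ContinuousLinearMap.comp_apply, ContinuousLinearMap.flip_apply,
      fderiv_clm_apply_const hDΦd]
    rw [add_comm]
  rw [apply_connectionCurvature_of_gauge (A := fun x u => christoffelMap G (Φ x) (fderiv ℝ Φ x u))
    (hG.self_of_nhds.formPullback hΦy hinj.self_of_nhds).differentiableAt_christoffelMap hDΦ
    (fun v => by fun_prop) hgauge]
  simp only [hderiv, (isSymmSndFDerivAt_of_contDiffAt_infty hΦy).eq u v,
    connectionCurvature_apply, add_apply]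
  abel

theorem scalarCurvatureOn_formPullback :
    scalarCurvatureOn (formPullback Φ G) y = scalarCurvatureOn G (Φ y) := by
  have hG' := eventually_isMetricPoint_formPullback hG hΦ hinj
  obtain ⟨e, he⟩ := hG'.self_of_nhds.exists_basis_orthonormal rfl
  let L : V ≃ₗ[ℝ] V :=
    LinearEquiv.ofInjectiveEndo (fderiv ℝ Φ y : V →ₗ[ℝ] V) hinj.self_of_nhds
  have hL (i) : e.map L i = fderiv ℝ Φ y (e i) := by simp [L]
  have hLe (i j) : G (Φ y) (e.map L i) (e.map L j) = if i = j then 1 else 0 := by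
    simp only [hL]
    exact he i j
  rw [scalarCurvatureOn_eq_sum hG' he, scalarCurvatureOn_eq_sum hG hLe]
  simp only [hL, ← fderiv_connectionCurvature_formPullback hG hΦ hinj]
  rfl

end Isometry

/-! ## Curvature of Kaluza–Klein metrics -/

section KaluzaKlein

open ContinuousLinearMap (fst snd compL)

variable {E W : Type*} [NormedAddCommGroup E] [NormedSpace ℝ E]
  [NormedAddCommGroup W] [NormedSpace ℝ W]

/-- The exterior derivative of a vector-valued 1-form on a vector space. -/
noncomputable def oneFormCurl (α : E → E →L[ℝ] W) (x : E) : E →L[ℝ] E →L[ℝ] W :=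
  fderiv ℝ α x - (fderiv ℝ α x).flip

theorem oneFormCurl_apply (α : E → E →L[ℝ] W) (x u v : E) :
    oneFormCurl α x u v = fderiv ℝ α x u v - fderiv ℝ α x v u := by
  simp [oneFormCurl]

theorem oneFormCurl_self (α : E → E →L[ℝ] W) (x u : E) : oneFormCurl α x u u = 0 := by
  simp [oneFormCurl_apply]

theorem oneFormCurl_swap (α : E → E →L[ℝ] W) (x u v : E) :
    oneFormCurl α x v u = -oneFormCurl α x u v := by
  simp [oneFormCurl_apply]

theorem contDiffAt_oneFormCurl {α : E → E →L[ℝ] W} {x : E} (hα : ContDiffAt ℝ ∞ α x) :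
    ContDiffAt ℝ ∞ (oneFormCurl α) x := by
  have hDα : ContDiffAt ℝ ∞ (fderiv ℝ α) x := hα.fderiv_right (by simp)
  exact hDα.sub ((ContinuousLinearMap.flipₗᵢ ℝ E E W).contDiff.contDiffAt.comp x hDα)

/-- The field of endomorphisms dual to the curvature `dα`: `h(B(a, w), b) = k(w, dα(a, b))`. -/
noncomputable def curlDual (h : E → E →L[ℝ] E →L[ℝ] ℝ) (k : W →L[ℝ] W →L[ℝ] ℝ)
    (α : E → E →L[ℝ] W) (x : E) : E →L[ℝ] W →L[ℝ] E :=
  (compL ℝ W (E →L[ℝ] ℝ) E (ContinuousLinearMap.inverse (h x))) ∘L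
    ((compL ℝ W (W →L[ℝ] ℝ) (E →L[ℝ] ℝ)).flip k) ∘L (compL ℝ E W ℝ).flip ∘L oneFormCurl α x

/-- The coframe `ξ ↦ (dπ ξ, ω ξ)` of the metric `g_λ`, where `λ` is given by `α` and the
Maurer–Cartan form of the fiber is given by `θ`. -/
noncomputable def bundleFrame (α : E → E →L[ℝ] W) (θ : W → W →L[ℝ] W) (x : E × W) :
    E × W →L[ℝ] E × W :=
  (fst ℝ E W).prod (α x.1 ∘L fst ℝ E W + θ x.2 ∘L snd ℝ E W)

theorem bundleFrame_apply (α : E → E →L[ℝ] W) (θ : W → W →L[ℝ] W) (x v : E × W) :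
    bundleFrame α θ x v = (v.1, α x.1 v.1 + θ x.2 v.2) := rfl

theorem fst_bundleFrame (α : E → E →L[ℝ] W) (θ : W → W →L[ℝ] W) (x v : E × W) :
    (bundleFrame α θ x v).1 = v.1 := rfl

/-- The direct sum of the scalar products `h x` and `k`. -/
noncomputable def sumMetric (h : E → E →L[ℝ] E →L[ℝ] ℝ) (k : W →L[ℝ] W →L[ℝ] ℝ) (x : E × W) :
    E × W →L[ℝ] E × W →L[ℝ] ℝ :=
  (h x.1).bilinearComp (fst ℝ E W) (fst ℝ E W) + k.bilinearComp (snd ℝ E W) (snd ℝ E W)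

theorem sumMetric_apply (h : E → E →L[ℝ] E →L[ℝ] ℝ) (k : W →L[ℝ] W →L[ℝ] ℝ) (x u v : E × W) :
    sumMetric h k x u v = h x.1 u.1 v.1 + k u.2 v.2 := rfl

/-- The metric `g_λ` in a product chart. -/
noncomputable def kaluzaKleinMetric (h : E → E →L[ℝ] E →L[ℝ] ℝ) (k : W →L[ℝ] W →L[ℝ] ℝ)
    (α : E → E →L[ℝ] W) (θ : W → W →L[ℝ] W) (x : E × W) : E × W →L[ℝ] E × W →L[ℝ] ℝ :=
  (sumMetric h k x).bilinearComp (bundleFrame α θ x) (bundleFrame α θ x)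

theorem kaluzaKleinMetric_apply (h : E → E →L[ℝ] E →L[ℝ] ℝ) (k : W →L[ℝ] W →L[ℝ] ℝ)
    (α : E → E →L[ℝ] W) (θ : W → W →L[ℝ] W) (x u v : E × W) :
    kaluzaKleinMetric h k α θ x u v =
      sumMetric h k x (bundleFrame α θ x u) (bundleFrame α θ x v) := rfl

/-- The connection form of the Levi-Civita connection of `kaluzaKleinMetric` in the coframe
`bundleFrame`. -/
noncomputable def bundleConnection (h : E → E →L[ℝ] E →L[ℝ] ℝ) (k : W →L[ℝ] W →L[ℝ] ℝ)
    (α : E → E →L[ℝ] W) (θ : W → W →L[ℝ] W) (x v : E × W) : E × W →L[ℝ] E × W :=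
  (christoffelMap h x.1 v.1 ∘L fst ℝ E W + (1 / 2 : ℝ) • (curlDual h k α x.1 v.1 ∘L snd ℝ E W)
    + (1 / 2 : ℝ) • ((curlDual h k α x.1).flip (bundleFrame α θ x v).2 ∘L fst ℝ E W)).prod
  (-(1 / 2 : ℝ) • (oneFormCurl α x.1 v.1 ∘L fst ℝ E W))

theorem bundleConnection_apply (h : E → E →L[ℝ] E →L[ℝ] ℝ) (k : W →L[ℝ] W →L[ℝ] ℝ)
    (α : E → E →L[ℝ] W) (θ : W → W →L[ℝ] W) (x v s : E × W) :
    bundleConnection h k α θ x v s =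
      (christoffelMap h x.1 v.1 s.1 + (1 / 2 : ℝ) • curlDual h k α x.1 v.1 s.2
        + (1 / 2 : ℝ) • curlDual h k α x.1 s.1 (bundleFrame α θ x v).2,
      -(1 / 2 : ℝ) • oneFormCurl α x.1 v.1 s.1) := rfl

theorem sum_sq_of_orthonormal {κ : Type*} [Fintype κ] [DecidableEq κ] {b : E →L[ℝ] E →L[ℝ] ℝ}
    {e : Module.Basis κ ℝ E} (he : ∀ i j, b (e i) (e j) = if i = j then 1 else 0) (x : E) :
    ∑ i, b x (e i) ^ 2 = b x x := by
  have hcoord (i : κ) : e.repr x i = b x (e i) :=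
    coord_eq_apply_of_orthonormal (b := ContinuousLinearMap.toLinearMap₁₂ b) he i x
  calc ∑ i, b x (e i) ^ 2 = b x (∑ i, e.repr x i • e i) := by
        simp only [hcoord, map_sum, map_smul, smul_eq_mul, sq]
    _ = b x x := by rw [e.sum_repr]

/-- The local data of the metric `g_λ` at the point `x` of a product chart: a metric `h` on the
base, a scalar product `k` on the Lie algebra, and smooth 1-forms `α` and `θ`, with `θ` pointwise
invertible and closed (the Maurer–Cartan equation of an abelian group). -/
structure IsBundlePoint (h : E → E →L[ℝ] E →L[ℝ] ℝ) (k : W →L[ℝ] W →L[ℝ] ℝ)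
    (α : E → E →L[ℝ] W) (θ : W → W →L[ℝ] W) (x : E × W) : Prop where
  base : IsMetricPoint h x.1
  symm : ∀ a b, k a b = k b a
  pos : ∀ a, a ≠ 0 → 0 < k a a
  smooth_form : ContDiffAt ℝ ∞ α x.1
  smooth_fiber : ContDiffAt ℝ ∞ θ x.2
  injective_fiber : Function.Injective (θ x.2)
  closed_fiber : ∀ a b, fderiv ℝ θ x.2 a b = fderiv ℝ θ x.2 b a

namespace IsBundlePoint

variable {h : E → E →L[ℝ] E →L[ℝ] ℝ} {k : W →L[ℝ] W →L[ℝ] ℝ}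
  {α : E → E →L[ℝ] W} {θ : W → W →L[ℝ] W} {x : E × W}

theorem sumMetric_symm (hx : IsBundlePoint h k α θ x) (a b : E × W) :
    sumMetric h k x a b = sumMetric h k x b a := by
  rw [sumMetric_apply, sumMetric_apply, hx.base.symm, hx.symm]

theorem sumMetric_pos (hx : IsBundlePoint h k α θ x) (a : E × W) (ha : a ≠ 0) :
    0 < sumMetric h k x a a := by
  rw [sumMetric_apply]
  by_cases hfst : a.1 = 0
  · have hsnd : a.2 ≠ 0 := fun hsnd => ha (Prod.ext hfst hsnd)
    simpa [hfst] using hx.pos _ hsnd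
  · have hbase := hx.base.pos _ hfst
    by_cases hsnd : a.2 = 0
    · simpa [hsnd] using hbase
    · exact add_pos hbase (hx.pos _ hsnd)

theorem injective_bundleFrame (hx : IsBundlePoint h k α θ x) :
    Function.Injective (bundleFrame α θ x) := by
  intro u v huv
  rw [bundleFrame_apply, bundleFrame_apply, Prod.mk.injEq] at huv
  obtain ⟨hfst, hsnd⟩ := huv
  rw [hfst, add_right_inj] at hsnd
  exact Prod.ext hfst (hx.injective_fiber hsnd)

theorem hasFDerivAt_bundleFrame_apply (hx : IsBundlePoint h k α θ x) (v : E × W) :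
    HasFDerivAt (fun y => bundleFrame α θ y v)
      ((0 : E × W →L[ℝ] E).prod
        ((fderiv ℝ α x.1).flip v.1 ∘L fst ℝ E W + (fderiv ℝ θ x.2).flip v.2 ∘L snd ℝ E W)) x := by
  have hα := (hx.smooth_form.differentiableAt (by simp)).hasFDerivAt.comp x
    (hasFDerivAt_fst (𝕜 := ℝ) (E := E) (F := W) (p := x))
  have hθ := (hx.smooth_fiber.differentiableAt (by simp)).hasFDerivAt.comp x
    (hasFDerivAt_snd (𝕜 := ℝ) (E := E) (F := W) (p := x))
  refine ((hasFDerivAt_const v.1 x).prodMk ((hα.clm_apply (hasFDerivAt_const v.1 x)).add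
    (hθ.clm_apply (hasFDerivAt_const v.2 x)))).congr_fderiv ?_
  ext <;> simp

theorem eventually_base (hx : ∀ᶠ y in 𝓝 x, IsBundlePoint h k α θ y) :
    ∀ᶠ y in 𝓝 x.1, IsMetricPoint h y := by
  have hslice : ContinuousAt (fun a : E => (a, x.2)) x.1 := by fun_prop
  exact (hslice.eventually hx).mono fun y hy => hy.base

variable [FiniteDimensional ℝ E]

theorem apply_curlDual (hx : IsBundlePoint h k α θ x) (a b : E) (w : W) :
    h x.1 (curlDual h k α x.1 a w) b = k w (oneFormCurl α x.1 a b) :=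
  hx.base.apply_inverse _ _

theorem sum_apply_curlDual_self [FiniteDimensional ℝ W] (hx : IsBundlePoint h k α θ x)
    {ι κ : Type*} [Fintype ι] [DecidableEq ι] [Fintype κ] [DecidableEq κ]
    {f : Module.Basis ι ℝ E} (hf : ∀ i j, h x.1 (f i) (f j) = if i = j then 1 else 0)
    {w : Module.Basis κ ℝ W} (hw : ∀ i j, k (w i) (w j) = if i = j then 1 else 0) (p : E) :
    ∑ m, h x.1 (curlDual h k α x.1 p (w m)) (curlDual h k α x.1 p (w m)) =
      ∑ j, k (oneFormCurl α x.1 p (f j)) (oneFormCurl α x.1 p (f j)) := by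
  simp only [← sum_sq_of_orthonormal hf, ← sum_sq_of_orthonormal hw, hx.apply_curlDual,
    hx.symm (w _)]
  exact Finset.sum_comm

variable [FiniteDimensional ℝ W]

theorem contDiffAt_curlDual (hx : IsBundlePoint h k α θ x) :
    ContDiffAt ℝ ∞ (curlDual h k α) x.1 := by
  refine contDiffAt_of_clm_apply fun a => contDiffAt_of_clm_apply fun w => ?_
  exact hx.base.contDiffAt_inverse.clm_apply (contDiffAt_const.clm_comp
    ((contDiffAt_oneFormCurl hx.smooth_form).clm_apply contDiffAt_const))

theorem contDiffAt_sumMetric (hx : IsBundlePoint h k α θ x) :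
    ContDiffAt ℝ ∞ (sumMetric h k) x := by
  refine contDiffAt_of_clm_apply fun a => contDiffAt_of_clm_apply fun w => ?_
  simp only [sumMetric_apply]
  have hh : ContDiffAt ℝ ∞ (fun y : E × W => h y.1) x := hx.base.smooth.comp x contDiffAt_fst
  exact ((hh.clm_apply contDiffAt_const).clm_apply contDiffAt_const).add contDiffAt_const

theorem contDiffAt_bundleFrame (hx : IsBundlePoint h k α θ x) :
    ContDiffAt ℝ ∞ (bundleFrame α θ) x := by
  refine contDiffAt_of_clm_apply fun v => ?_
  simp only [bundleFrame_apply]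
  have hα : ContDiffAt ℝ ∞ (fun y : E × W => α y.1) x := hx.smooth_form.comp x contDiffAt_fst
  have hθ : ContDiffAt ℝ ∞ (fun y : E × W => θ y.2) x := hx.smooth_fiber.comp x contDiffAt_snd
  exact contDiffAt_const.prodMk
    ((hα.clm_apply contDiffAt_const).add (hθ.clm_apply contDiffAt_const))

theorem isMetricPoint (hx : IsBundlePoint h k α θ x) :
    IsMetricPoint (kaluzaKleinMetric h k α θ) x :=
  IsMetricPoint.bilinearComp hx.contDiffAt_sumMetric hx.contDiffAt_bundleFrame hx.sumMetric_symm
    hx.sumMetric_pos hx.injective_bundleFrame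

theorem fderiv_bundleFrame (hx : IsBundlePoint h k α θ x) (u v : E × W) :
    fderiv ℝ (bundleFrame α θ) x u v = (0, fderiv ℝ α x.1 u.1 v.1 + fderiv ℝ θ x.2 u.2 v.2) := by
  rw [← fderiv_clm_apply_const (hx.contDiffAt_bundleFrame.differentiableAt (by simp)),
    (hx.hasFDerivAt_bundleFrame_apply v).fderiv]
  simp

theorem fderiv_bundleFrame_sub (hx : IsBundlePoint h k α θ x) (u v : E × W) :
    fderiv ℝ (bundleFrame α θ) x u v - fderiv ℝ (bundleFrame α θ) x v u =
      (0, oneFormCurl α x.1 u.1 v.1) := by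
  rw [hx.fderiv_bundleFrame, hx.fderiv_bundleFrame, hx.closed_fiber u.2, oneFormCurl_apply]
  simp

theorem fderiv_sumMetric (hx : IsBundlePoint h k α θ x) (u a b : E × W) :
    fderiv ℝ (sumMetric h k) x u a b = fderiv ℝ h x.1 u.1 a.1 b.1 := by
  rw [← fderiv_clm_apply_const₂ (hx.contDiffAt_sumMetric.differentiableAt (by simp))]
  have hh := hx.base.differentiableAt.hasFDerivAt.comp x
    (hasFDerivAt_fst (𝕜 := ℝ) (E := E) (F := W) (p := x))
  have hsum := (((hh.clm_apply (hasFDerivAt_const a.1 x)).clm_apply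
    (hasFDerivAt_const b.1 x)).add_const (k a.2 b.2)).fderiv
  simp only [Function.comp_apply] at hsum
  simp only [sumMetric_apply, hsum]
  simp

theorem fderiv_bundleConnection_apply (hx : IsBundlePoint h k α θ x) (u v s : E × W) :
    fderiv ℝ (fun y => bundleConnection h k α θ y v s) x u =
      (fderiv ℝ (christoffelMap h) x.1 u.1 v.1 s.1
        + (1 / 2 : ℝ) • fderiv ℝ (curlDual h k α) x.1 u.1 v.1 s.2
        + (1 / 2 : ℝ) • (fderiv ℝ (curlDual h k α) x.1 u.1 s.1 (bundleFrame α θ x v).2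
          + curlDual h k α x.1 s.1 (fderiv ℝ (bundleFrame α θ) x u v).2),
      -(1 / 2 : ℝ) • fderiv ℝ (oneFormCurl α) x.1 u.1 v.1 s.1) := by
  have hfst := hasFDerivAt_fst (𝕜 := ℝ) (E := E) (F := W) (p := x)
  have hΓ := hx.base.differentiableAt_christoffelMap.hasFDerivAt.comp x hfst
  have hB := (hx.contDiffAt_curlDual.differentiableAt (by simp)).hasFDerivAt.comp x hfst
  have hΩ := ((contDiffAt_oneFormCurl hx.smooth_form).differentiableAt
    (by simp)).hasFDerivAt.comp x hfst
  have hP := (hx.hasFDerivAt_bundleFrame_apply v).snd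
  have hv := hasFDerivAt_const (𝕜 := ℝ) v.1 x
  have hs := hasFDerivAt_const (𝕜 := ℝ) s.1 x
  have hderiv := ((((hΓ.clm_apply hv).clm_apply hs).add
    (((hB.clm_apply hv).clm_apply (hasFDerivAt_const s.2 x)).const_smul (1 / 2 : ℝ))).add
    (((hB.clm_apply hs).clm_apply hP).const_smul (1 / 2 : ℝ))).prodMk
    (((hΩ.clm_apply hv).clm_apply hs).const_smul (-(1 / 2) : ℝ))
  simp only [bundleConnection_apply]
  refine (DFunLike.congr_fun hderiv.fderiv u).trans ?_
  rw [hx.fderiv_bundleFrame]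
  ext <;> simp [add_comm]

theorem differentiableAt_bundleConnection (hx : IsBundlePoint h k α θ x) (v : E × W) :
    DifferentiableAt ℝ (fun y => bundleConnection h k α θ y v) x := by
  refine (contDiffAt_of_clm_apply fun s => ?_ : ContDiffAt ℝ ∞ _ x).differentiableAt (by simp)
  simp only [bundleConnection_apply]
  have hΓ : ContDiffAt ℝ ∞ (fun y : E × W => christoffelMap h y.1) x :=
    hx.base.contDiffAt_christoffelMap.comp x contDiffAt_fst
  have hB : ContDiffAt ℝ ∞ (fun y : E × W => curlDual h k α y.1) x :=
    hx.contDiffAt_curlDual.comp x contDiffAt_fst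
  have hΩ : ContDiffAt ℝ ∞ (fun y : E × W => oneFormCurl α y.1) x :=
    (contDiffAt_oneFormCurl hx.smooth_form).comp x contDiffAt_fst
  have hP := (hx.contDiffAt_bundleFrame.clm_apply (contDiffAt_const (c := v))).snd
  fun_prop

theorem bundleFrame_christoffelMap (hx : IsBundlePoint h k α θ x) (u v : E × W) :
    bundleFrame α θ x (christoffelMap (kaluzaKleinMetric h k α θ) x u v) =
      fderiv ℝ (bundleFrame α θ) x u v + bundleConnection h k α θ x u (bundleFrame α θ x v) := by
  have hsurj : Function.Surjective (bundleFrame α θ x) :=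
    LinearMap.injective_iff_surjective (f := (bundleFrame α θ x : E × W →ₗ[ℝ] E × W)).1
      hx.injective_bundleFrame
  suffices hΓ : ∀ w, sumMetric h k x
      (bundleFrame α θ x (christoffelMap (kaluzaKleinMetric h k α θ) x u v))
        (bundleFrame α θ x w) =
      sumMetric h k x (fderiv ℝ (bundleFrame α θ) x u v +
        bundleConnection h k α θ x u (bundleFrame α θ x v)) (bundleFrame α θ x w) by
    rw [← sub_eq_zero]
    by_contra hne
    obtain ⟨w, hw⟩ := hsurj (bundleFrame α θ x (christoffelMap (kaluzaKleinMetric h k α θ) x u v) -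
      (fderiv ℝ (bundleFrame α θ) x u v + bundleConnection h k α θ x u (bundleFrame α θ x v)))
    have hpos := hx.sumMetric_pos _ hne
    rw [← hw] at hpos
    nth_rewrite 1 [hw] at hpos
    rw [map_sub, sub_apply, hΓ, sub_self] at hpos
    exact lt_irrefl 0 hpos
  intro w
  rw [show kaluzaKleinMetric h k α θ = fun y => (sumMetric h k y).bilinearComp
      (bundleFrame α θ y) (bundleFrame α θ y) from rfl,
    apply_christoffelMap_bilinearComp hx.contDiffAt_sumMetric
      hx.contDiffAt_bundleFrame hx.sumMetric_symm hx.sumMetric_pos hx.injective_bundleFrame,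
    hx.fderiv_bundleFrame_sub, hx.fderiv_bundleFrame_sub]
  simp only [hx.fderiv_sumMetric, hx.fderiv_bundleFrame,
    sumMetric_apply, bundleConnection_apply, map_add, map_smul, add_apply, smul_apply, smul_eq_mul,
    hx.base.apply_christoffelMap, hx.apply_curlDual, map_zero, zero_apply, fst_bundleFrame]
  rw [oneFormCurl_apply α x.1 u.1 v.1, hx.closed_fiber u.2, map_sub, sub_apply]
  ring

variable (hx : ∀ᶠ y in 𝓝 x, IsBundlePoint h k α θ y)

include hx

theorem bundleFrame_connectionCurvature (u v w : E × W) :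
    bundleFrame α θ x (connectionCurvature (christoffelMap (kaluzaKleinMetric h k α θ)) x u v w) =
      fderiv ℝ (fun y => bundleConnection h k α θ y v (bundleFrame α θ x w)) x u
        - fderiv ℝ (fun y => bundleConnection h k α θ y u (bundleFrame α θ x w)) x v
        + bundleConnection h k α θ x u (bundleConnection h k α θ x v (bundleFrame α θ x w))
        - bundleConnection h k α θ x v (bundleConnection h k α θ x u (bundleFrame α θ x w)) := by
  have hx₀ := hx.self_of_nhds
  rw [apply_connectionCurvature_of_gauge (A := bundleConnection h k α θ)
    hx₀.isMetricPoint.differentiableAt_christoffelMap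
    hx₀.contDiffAt_bundleFrame hx₀.differentiableAt_bundleConnection
    (hx.mono fun y hy => hy.bundleFrame_christoffelMap),
    fderiv_clm_apply_const (hx₀.differentiableAt_bundleConnection v),
    fderiv_clm_apply_const (hx₀.differentiableAt_bundleConnection u)]

theorem curvature_horizontal {a b : E × W} {p q : E} (ha : bundleFrame α θ x a = (p, 0))
    (hb : bundleFrame α θ x b = (q, 0)) :
    kaluzaKleinMetric h k α θ x
        (connectionCurvature (christoffelMap (kaluzaKleinMetric h k α θ)) x a b b) a =
      h x.1 (connectionCurvature (christoffelMap h) x.1 p q q) p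
        - 3 / 4 * k (oneFormCurl α x.1 p q) (oneFormCurl α x.1 p q) := by
  have hx₀ := hx.self_of_nhds
  have ha₁ : a.1 = p := congrArg Prod.fst ha
  have hb₁ : b.1 = q := congrArg Prod.fst hb
  have hcurl : k (fderiv ℝ (bundleFrame α θ) x a b).2 (oneFormCurl α x.1 p q) -
      k (fderiv ℝ (bundleFrame α θ) x b a).2 (oneFormCurl α x.1 p q) =
      k (oneFormCurl α x.1 p q) (oneFormCurl α x.1 p q) := by
    rw [← sub_apply, ← map_sub, ← Prod.snd_sub, hx₀.fderiv_bundleFrame_sub, ha₁, hb₁]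
  rw [kaluzaKleinMetric_apply, bundleFrame_connectionCurvature hx, ha, hb]
  simp only [hx₀.fderiv_bundleConnection_apply]
  simp only [bundleConnection_apply, sumMetric_apply, ha, hb,
    ha₁, hb₁, connectionCurvature_apply]
  simp only [one_div, map_zero, smul_zero, add_zero, zero_add, neg_smul, Prod.mk_sub_mk,
    sub_neg_eq_add, oneFormCurl_self, Prod.mk_add_mk, map_neg, map_smul, smul_neg, map_sub,
    map_add, sub_apply, add_apply, smul_apply, hx₀.apply_curlDual, oneFormCurl_swap α x.1 p q,
    smul_eq_mul, mul_neg, neg_apply, neg_neg]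
  linarith

theorem curvature_vertizontal {a b : E × W} {p : E} {w : W} (ha : bundleFrame α θ x a = (p, 0))
    (hb : bundleFrame α θ x b = (0, w)) :
    kaluzaKleinMetric h k α θ x
        (connectionCurvature (christoffelMap (kaluzaKleinMetric h k α θ)) x a b b) a =
      1 / 4 * h x.1 (curlDual h k α x.1 p w) (curlDual h k α x.1 p w) := by
  have hx₀ := hx.self_of_nhds
  have ha₁ : a.1 = p := congrArg Prod.fst ha
  have hb₁ : b.1 = 0 := congrArg Prod.fst hb
  rw [kaluzaKleinMetric_apply, bundleFrame_connectionCurvature hx, ha, hb]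
  simp only [hx₀.fderiv_bundleConnection_apply]
  simp only [bundleConnection_apply, sumMetric_apply, ha, hb,
    ha₁, hb₁]
  simp only [map_zero, zero_apply, one_div, smul_zero, add_zero, sub_self, zero_add, map_smul,
    smul_apply, Prod.mk_sub_mk, zero_sub, map_neg, neg_apply, hx₀.apply_curlDual,
    oneFormCurl_swap α x.1 p, smul_eq_mul, mul_neg, neg_neg]
  ring

theorem curvature_vertizontal' {a b : E × W} {p : E} {w : W} (ha : bundleFrame α θ x a = (0, w))
    (hb : bundleFrame α θ x b = (p, 0)) :
    kaluzaKleinMetric h k α θ x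
        (connectionCurvature (christoffelMap (kaluzaKleinMetric h k α θ)) x a b b) a =
      1 / 4 * h x.1 (curlDual h k α x.1 p w) (curlDual h k α x.1 p w) := by
  have hx₀ := hx.self_of_nhds
  have ha₁ : a.1 = 0 := congrArg Prod.fst ha
  have hb₁ : b.1 = p := congrArg Prod.fst hb
  rw [kaluzaKleinMetric_apply, bundleFrame_connectionCurvature hx, ha, hb]
  simp only [hx₀.fderiv_bundleConnection_apply]
  simp only [bundleConnection_apply, sumMetric_apply, ha, hb,
    ha₁, hb₁]
  simp only [map_zero, zero_apply, one_div, smul_zero, add_zero, zero_add, smul_add,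
    Prod.mk_sub_mk, sub_self, neg_smul, Prod.mk_add_mk, map_smul, smul_apply, sub_neg_eq_add,
    map_sub, map_add, hx₀.apply_curlDual, smul_eq_mul, hx₀.symm w]
  ring

theorem curvature_vertical {a b : E × W} {w w' : W} (ha : bundleFrame α θ x a = (0, w))
    (hb : bundleFrame α θ x b = (0, w')) :
    kaluzaKleinMetric h k α θ x
      (connectionCurvature (christoffelMap (kaluzaKleinMetric h k α θ)) x a b b) a = 0 := by
  have hx₀ := hx.self_of_nhds
  have ha₁ : a.1 = 0 := congrArg Prod.fst ha
  have hb₁ : b.1 = 0 := congrArg Prod.fst hb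
  rw [kaluzaKleinMetric_apply, bundleFrame_connectionCurvature hx, ha, hb]
  simp only [hx₀.fderiv_bundleConnection_apply]
  simp only [bundleConnection_apply, sumMetric_apply, ha, hb,
    ha₁, hb₁]
  simp

theorem scalarCurvatureOn_kaluzaKleinMetric {ι : Type*} [Fintype ι] [DecidableEq ι]
    {f : Module.Basis ι ℝ E} (hf : ∀ i j, h x.1 (f i) (f j) = if i = j then 1 else 0) :
    scalarCurvatureOn (kaluzaKleinMetric h k α θ) x =
      scalarCurvatureOn h x.1 - 1 / 4 * ∑ i, ∑ j,
        k (oneFormCurl α x.1 (f i) (f j)) (oneFormCurl α x.1 (f i) (f j)) := by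
  have hx₀ := hx.self_of_nhds
  obtain ⟨w, hw⟩ := exists_basis_orthonormal_of_pos
    (b := ContinuousLinearMap.toLinearMap₁₂ k) hx₀.symm hx₀.pos rfl
  have horth (i j) : k (w i) (w j) = if i = j then 1 else 0 := hw i j
  let L : (E × W) ≃ₗ[ℝ] (E × W) := LinearEquiv.ofInjectiveEndo
    (bundleFrame α θ x : E × W →ₗ[ℝ] E × W) hx₀.injective_bundleFrame
  let e := (f.prod w).map L.symm
  have hinl (i) : bundleFrame α θ x (e (Sum.inl i)) = (f i, 0) :=
    (L.apply_symm_apply _).trans (by simp [Module.Basis.prod_apply])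
  have hinr (i) : bundleFrame α θ x (e (Sum.inr i)) = (0, w i) :=
    (L.apply_symm_apply _).trans (by simp [Module.Basis.prod_apply])
  have he (i j) : kaluzaKleinMetric h k α θ x (e i) (e j) = if i = j then 1 else 0 := by
    rw [kaluzaKleinMetric_apply, sumMetric_apply]
    rcases i with i | i <;> rcases j with j | j <;> simp [hinl, hinr, hf, horth]
  rw [scalarCurvatureOn_eq_sum (hx.mono fun y hy => hy.isMetricPoint) he,
    scalarCurvatureOn_eq_sum (eventually_base hx) hf]
  simp only [Fintype.sum_sum_type, curvature_horizontal hx (hinl _) (hinl _),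
    curvature_vertizontal hx (hinl _) (hinr _), curvature_vertizontal' hx (hinr _) (hinl _),
    curvature_vertical hx (hinr _) (hinr _), Finset.sum_add_distrib, Finset.sum_sub_distrib,
    ← Finset.mul_sum, hx₀.sum_apply_curlDual_self hf horth, Finset.sum_const_zero]
  rw [Finset.sum_comm (f := fun m i => h x.1 (curlDual h k α x.1 (f i) (w m)) _)]
  simp only [hx₀.sum_apply_curlDual_self hf horth]
  rw [Finset.sum_comm (f := fun j i => k (oneFormCurl α x.1 (f i) (f j)) _)]
  ring

end IsBundlePoint

end KaluzaKlein

/-! ## Metrics and 1-forms in charts -/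

section Continuity

variable {V : Type*} [NormedAddCommGroup V] [NormedSpace ℝ V] [FiniteDimensional ℝ V]
  {G : V → V →L[ℝ] V →L[ℝ] ℝ} {y : V}

theorem IsMetricPoint.continuousAt_connectionCurvature (hG : IsMetricPoint G y) :
    ContinuousAt (connectionCurvature (christoffelMap G)) y := by
  have hΓ : ContDiffAt ℝ ∞ (christoffelMap G) y := hG.contDiffAt_christoffelMap
  have : ContDiffAt ℝ ∞ (fderiv ℝ (christoffelMap G)) y := hΓ.fderiv_right (by simp)
  suffices ContDiffAt ℝ ∞ (connectionCurvature (christoffelMap G)) y from this.continuousAt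
  refine contDiffAt_of_clm_apply fun u => contDiffAt_of_clm_apply fun v =>
    contDiffAt_of_clm_apply fun w => ?_
  simp only [connectionCurvature_apply]
  fun_prop

theorem continuousAt_scalarCurvatureOn (hG : ∀ᶠ z in 𝓝 y, IsMetricPoint G z) :
    ContinuousAt (scalarCurvatureOn G) y := by
  have hR := hG.self_of_nhds.continuousAt_connectionCurvature
  have hinv := hG.self_of_nhds.contDiffAt_inverse.continuousAt
  have hterm (u v : V) (l : V →L[ℝ] ℝ) : ContinuousAt (fun z =>
      connectionCurvature (christoffelMap G) z u v (ContinuousLinearMap.inverse (G z) l)) y := by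
    fun_prop
  have hcurv : (fun z => ∑ i, ∑ j, (Module.finBasis ℝ V).coord j
      (connectionCurvature (christoffelMap G) z (Module.finBasis ℝ V j) (Module.finBasis ℝ V i)
        (ContinuousLinearMap.inverse (G z)
          (LinearMap.toContinuousLinearMap ((Module.finBasis ℝ V).coord i))))) =ᶠ[𝓝 y]
      scalarCurvatureOn G := by
    filter_upwards [hG.eventually_nhds] with z hz
    simp only [scalarCurvatureOn, ricci, curvatureTensor_eq_connectionCurvature hz]
  refine ContinuousAt.congr ?_ hcurv
  refine tendsto_finsetSum _ fun i _ => tendsto_finsetSum _ fun j _ => ?_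
  exact (LinearMap.continuous_of_finiteDimensional _).continuousAt.comp (hterm _ _ _)

end Continuity

section Charts

variable {V : Type*} [NormedAddCommGroup V] [NormedSpace ℝ V]
  {B : Type*} [TopologicalSpace B] {I : ModelWithCorners ℝ V B}
  {M : Type*} [TopologicalSpace M] [ChartedSpace B M]
  {F : Type*} [NormedAddCommGroup F] [NormedSpace ℝ F]

/-- The expression of a 1-form in the preferred chart at `x`. -/
noncomputable def oneFormInChart (I : ModelWithCorners ℝ V B)
    (α : ∀ p : M, TangentSpace I p →L[ℝ] F) (x : M) (y : V) : V →L[ℝ] F :=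
  let A : V →L[ℝ] V := mfderiv 𝓘(ℝ, V) I (extChartAt I x).symm y
  let a : V →L[ℝ] F := α ((extChartAt I x).symm y)
  a ∘L A

/-- `g` is a Riemannian metric: it is smooth and positive definite in every preferred chart. -/
def IsMetricInCharts (I : ModelWithCorners ℝ V B)
    (g : ∀ p : M, TangentSpace I p →L[ℝ] TangentSpace I p →L[ℝ] ℝ) : Prop :=
  ∀ x : M, ∀ y ∈ (extChartAt I x).target, IsMetricPoint (inChart I g x) y

/-- The 1-form `α` is smooth in every preferred chart. -/
def IsSmoothOneFormInCharts (I : ModelWithCorners ℝ V B)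
    (α : ∀ p : M, TangentSpace I p →L[ℝ] F) : Prop :=
  ∀ x : M, ∀ y ∈ (extChartAt I x).target, ContDiffAt ℝ ∞ (oneFormInChart I α x) y

variable [I.Boundaryless]

theorem IsMetricInCharts.eventually
    {g : ∀ p : M, TangentSpace I p →L[ℝ] TangentSpace I p →L[ℝ] ℝ} (hg : IsMetricInCharts I g)
    {x : M} {y : V} (hy : y ∈ (extChartAt I x).target) :
    ∀ᶠ z in 𝓝 y, IsMetricPoint (inChart I g x) z :=
  Filter.mem_of_superset ((isOpen_extChartAt_target x).mem_nhds hy) (hg x)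

variable [IsManifold I ∞ M] {x : M} {y : V}

theorem contMDiffAt_extChartAt_symm (hy : y ∈ (extChartAt I x).target) :
    ContMDiffAt 𝓘(ℝ, V) I ∞ (extChartAt I x).symm y :=
  (contMDiffOn_extChartAt_symm x).contMDiffAt ((isOpen_extChartAt_target x).mem_nhds hy)

theorem mdifferentiableAt_extChartAt_symm (hy : y ∈ (extChartAt I x).target) :
    MDifferentiableAt 𝓘(ℝ, V) I (extChartAt I x).symm y :=
  (contMDiffAt_extChartAt_symm hy).mdifferentiableAt (by simp)

theorem injective_mfderiv_extChartAt_symm (hy : y ∈ (extChartAt I x).target) :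
    Function.Injective (mfderiv 𝓘(ℝ, V) I (extChartAt I x).symm y) := by
  have hinv := isInvertible_mfderivWithin_extChartAt_symm (I := I) (x := x) hy
  rw [I.range_eq_univ, mfderivWithin_univ] at hinv
  obtain ⟨e, he⟩ := hinv
  rw [← he]
  exact e.injective

theorem contMDiffOn_mfderiv_extChartAt_symm (x : M) (u : V) :
    ContMDiffOn 𝓘(ℝ, V) I.tangent ∞
      (fun y => TotalSpace.mk' V (E := fun p : M => TangentSpace I p) ((extChartAt I x).symm y)
        (mfderiv 𝓘(ℝ, V) I (extChartAt I x).symm y u)) (extChartAt I x).target := by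
  have hconst : ContMDiff 𝓘(ℝ, V) 𝓘(ℝ, V).tangent ∞
      (fun y : V => TotalSpace.mk' V (E := fun p : V => TangentSpace 𝓘(ℝ, V) p) y u) := by
    intro y
    rw [contMDiffAt_totalSpace]
    refine ⟨contMDiffAt_id, ?_⟩
    simpa using contMDiffAt_const
  have htangent := (contMDiffOn_extChartAt_symm (I := I) (n := ∞) x).contMDiffOn_tangentMapWithin
    (m := ∞) (by simp) (isOpen_extChartAt_target x).uniqueMDiffOn
  refine (htangent.comp hconst.contMDiffOn (s := (extChartAt I x).target) fun y hy => hy).congr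
    fun y hy => ?_
  rw [Function.comp_apply, tangentMapWithin,
    mfderivWithin_of_isOpen (isOpen_extChartAt_target x) hy]

variable [FiniteDimensional ℝ V]

theorem IsSmoothOneForm.isSmoothOneFormInCharts {α : ∀ p : M, TangentSpace I p →L[ℝ] F}
    (hα : IsSmoothOneForm I α) : IsSmoothOneFormInCharts I α := by
  intro x y hy
  refine contDiffAt_of_clm_apply fun u => ?_
  have hsection : ContMDiffOn 𝓘(ℝ, V) (I.prod 𝓘(ℝ, F)) ∞
      (fun y => TotalSpace.mk' F (E := Bundle.Trivial M F) ((extChartAt I x).symm y)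
        (α ((extChartAt I x).symm y) (mfderiv 𝓘(ℝ, V) I (extChartAt I x).symm y u)))
      (extChartAt I x).target :=
    ContMDiffOn.clm_bundle_apply (E₁ := fun p : M => TangentSpace I p) (F₁ := V)
      (hα.comp_contMDiffOn (contMDiffOn_extChartAt_symm x))
      (contMDiffOn_mfderiv_extChartAt_symm x u)
  have hsectionAt := hsection.contMDiffAt ((isOpen_extChartAt_target x).mem_nhds hy)
  rw [contMDiffAt_totalSpace] at hsectionAt
  exact hsectionAt.2.contDiffAt

theorem contDiffAt_inChart
    (h : ContMDiffRiemannianMetric I ∞ V (fun p : M => TangentSpace I p))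
    (hy : y ∈ (extChartAt I x).target) : ContDiffAt ℝ ∞ (inChart I h.inner x) y := by
  refine contDiffAt_of_clm_apply fun u => contDiffAt_of_clm_apply fun v => ?_
  have hsection := ContMDiffOn.clm_bundle_apply₂ (E₁ := fun p : M => TangentSpace I p) (F₁ := V)
      (E₂ := fun p : M => TangentSpace I p) (F₂ := V) (E₃ := Bundle.Trivial M ℝ)
      (h.contMDiff.comp_contMDiffOn (contMDiffOn_extChartAt_symm x))
      (contMDiffOn_mfderiv_extChartAt_symm x u) (contMDiffOn_mfderiv_extChartAt_symm x v)
  have hsectionAt := hsection.contMDiffAt ((isOpen_extChartAt_target x).mem_nhds hy)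
  rw [contMDiffAt_totalSpace] at hsectionAt
  exact hsectionAt.2.contDiffAt

theorem isMetricInCharts_inner
    (h : ContMDiffRiemannianMetric I ∞ V (fun p : M => TangentSpace I p)) :
    IsMetricInCharts I h.inner := fun x y hy =>
  { smooth := contDiffAt_inChart h hy
    symm := fun u v => by
      rw [inChart_apply, inChart_apply]
      exact h.symm _ _ _
    pos := fun v hv => by
      rw [inChart_apply]
      exact h.pos _ _ fun hv0 =>
        hv (injective_mfderiv_extChartAt_symm hy (hv0.trans (map_zero _).symm)) }

end Charts

section Transition

variable {V : Type*} [NormedAddCommGroup V] [NormedSpace ℝ V]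
  {B : Type*} [TopologicalSpace B] {I : ModelWithCorners ℝ V B}
  {M : Type*} [TopologicalSpace M] [ChartedSpace B M]
  {g : ∀ p : M, TangentSpace I p →L[ℝ] TangentSpace I p →L[ℝ] ℝ}
  {f : M ≃ₘ^∞⟮I, I⟯ M} {x x' : M} {y : V}

/-- The expression of a map in the preferred charts at `x` and `x'`. -/
noncomputable def mapInCharts (I : ModelWithCorners ℝ V B) (f : M → M) (x x' : M) : V → V :=
  extChartAt I x' ∘ f ∘ (extChartAt I x).symm

theorem extChartAt_symm_mapInCharts {f : M → M}
    (hy' : f ((extChartAt I x).symm y) ∈ (extChartAt I x').source) :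
    (extChartAt I x').symm (mapInCharts I f x x' y) = f ((extChartAt I x).symm y) :=
  (extChartAt I x').left_inv hy'

theorem mapInCharts_mem_target {f : M → M}
    (hy' : f ((extChartAt I x).symm y) ∈ (extChartAt I x').source) :
    mapInCharts I f x x' y ∈ (extChartAt I x').target :=
  (extChartAt I x').map_source hy'

theorem isRiemannianIsometry_refl (g : ∀ p : M, TangentSpace I p →L[ℝ] TangentSpace I p →L[ℝ] ℝ) :
    IsRiemannianIsometry I g (Diffeomorph.refl I M ∞) := by
  intro p X Y
  have hid : mfderiv I I (Diffeomorph.refl I M ∞) p = ContinuousLinearMap.id ℝ _ := mfderiv_id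
  rw [hid]
  rfl

variable [I.Boundaryless]

theorem eventually_mapInCharts {f : M → M} (hf : Continuous f) (hy : y ∈ (extChartAt I x).target)
    (hy' : f ((extChartAt I x).symm y) ∈ (extChartAt I x').source) :
    ∀ᶠ z in 𝓝 y, z ∈ (extChartAt I x).target ∧
      f ((extChartAt I x).symm z) ∈ (extChartAt I x').source := by
  have hcont : ContinuousAt (fun z => f ((extChartAt I x).symm z)) y :=
    hf.continuousAt.comp (continuousAt_extChartAt_symm'' hy)
  exact Filter.Eventually.and ((isOpen_extChartAt_target x).mem_nhds hy)
    (hcont.eventually ((isOpen_extChartAt_source x').mem_nhds hy'))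

variable [IsManifold I ∞ M]

theorem contDiffAt_mapInCharts (hy : y ∈ (extChartAt I x).target)
    (hy' : f ((extChartAt I x).symm y) ∈ (extChartAt I x').source) :
    ContDiffAt ℝ ∞ (mapInCharts I f x x') y := by
  rw [extChartAt_source] at hy'
  exact ((contMDiffAt_extChartAt' (I := I) (n := ∞) hy').comp y
    ((f.contMDiff _).comp y (contMDiffAt_extChartAt_symm hy))).contDiffAt

theorem mfderiv_extChartAt_symm_mapInCharts (hy : y ∈ (extChartAt I x).target)
    (hy' : f ((extChartAt I x).symm y) ∈ (extChartAt I x').source) (u : V) :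
    (mfderiv 𝓘(ℝ, V) I (extChartAt I x').symm (mapInCharts I f x x' y)
      (fderiv ℝ (mapInCharts I f x x') y u) : V) =
    mfderiv I I f ((extChartAt I x).symm y) (mfderiv 𝓘(ℝ, V) I (extChartAt I x).symm y u) := by
  have hΦ : MDifferentiableAt 𝓘(ℝ, V) 𝓘(ℝ, V) (mapInCharts I f x x') y :=
    ((contDiffAt_mapInCharts hy hy').differentiableAt (by simp)).mdifferentiableAt
  have hf : MDifferentiableAt I I f ((extChartAt I x).symm y) :=
    (f.contMDiff _).mdifferentiableAt (by simp)
  have hleft := mfderiv_comp_apply y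
    (mdifferentiableAt_extChartAt_symm (mapInCharts_mem_target hy')) hΦ u
  have hright := mfderiv_comp_apply y hf (mdifferentiableAt_extChartAt_symm hy) u
  rw [mfderiv_eq_fderiv] at hleft
  refine (hleft.symm.trans ?_).trans hright
  have hcomp : ((extChartAt I x').symm ∘ mapInCharts I f x x') =ᶠ[𝓝 y]
      (f ∘ (extChartAt I x).symm) := by
    filter_upwards [eventually_mapInCharts f.continuous hy hy'] with z hz
      using extChartAt_symm_mapInCharts hz.2
  exact DFunLike.congr_fun (hcomp.mfderiv_eq : (mfderiv 𝓘(ℝ, V) I _ y : V →L[ℝ] V) = _) u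

theorem injective_fderiv_mapInCharts (hy : y ∈ (extChartAt I x).target)
    (hy' : f ((extChartAt I x).symm y) ∈ (extChartAt I x').source) :
    Function.Injective (fderiv ℝ (mapInCharts I f x x') y) := by
  intro u v huv
  have hu := mfderiv_extChartAt_symm_mapInCharts hy hy' u
  rw [huv, mfderiv_extChartAt_symm_mapInCharts hy hy' v] at hu
  exact (injective_mfderiv_extChartAt_symm hy
    ((f.mfderivToContinuousLinearEquiv (by simp) ((extChartAt I x).symm y)).injective hu)).symm

theorem IsRiemannianIsometry.inChart_eq (hf : IsRiemannianIsometry I g f)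
    (hy : y ∈ (extChartAt I x).target)
    (hy' : f ((extChartAt I x).symm y) ∈ (extChartAt I x').source) :
    inChart I g x y = formPullback (mapInCharts I f x x') (inChart I g x') y := by
  ext u v
  let b : M → V →L[ℝ] V →L[ℝ] ℝ := g
  exact (hf _ _ _).symm.trans (DFunLike.congr
    (DFunLike.congr (congrArg b (extChartAt_symm_mapInCharts hy'))
      (mfderiv_extChartAt_symm_mapInCharts hy hy' u))
    (mfderiv_extChartAt_symm_mapInCharts hy hy' v)).symm

theorem oneFormInChart_comp {F : Type*} [NormedAddCommGroup F]
    [NormedSpace ℝ F] {α α' : ∀ p : M, TangentSpace I p →L[ℝ] F}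
    (hf : ∀ p X, α' p X = α (f p) (mfderiv I I f p X)) (hy : y ∈ (extChartAt I x).target)
    (hy' : f ((extChartAt I x).symm y) ∈ (extChartAt I x').source) :
    oneFormInChart I α' x y = (oneFormInChart I α x' (mapInCharts I f x x' y)) ∘L
      (fderiv ℝ (mapInCharts I f x x') y) := by
  ext u
  let a : M → V →L[ℝ] F := α
  exact (hf _ _).trans (DFunLike.congr (congrArg a (extChartAt_symm_mapInCharts hy'))
    (mfderiv_extChartAt_symm_mapInCharts hy hy' u)).symm

variable [FiniteDimensional ℝ V]

theorem IsRiemannianIsometry.scalarCurvatureOn_inChart (hf : IsRiemannianIsometry I g f)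
    (hg : IsMetricInCharts I g) (hy : y ∈ (extChartAt I x).target)
    (hy' : f ((extChartAt I x).symm y) ∈ (extChartAt I x').source) :
    scalarCurvatureOn (inChart I g x) y =
      scalarCurvatureOn (inChart I g x') (mapInCharts I f x x' y) := by
  have hcharts := eventually_mapInCharts f.continuous hy hy'
  calc scalarCurvatureOn (inChart I g x) y
      = scalarCurvatureOn (formPullback (mapInCharts I f x x') (inChart I g x')) y :=
        scalarCurvatureOn_congr (hcharts.mono fun z hz => hf.inChart_eq hz.1 hz.2)
          (hg.eventually hy)
    _ = scalarCurvatureOn (inChart I g x') (mapInCharts I f x x' y) :=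
        scalarCurvatureOn_formPullback (hg.eventually (mapInCharts_mem_target hy'))
          (hcharts.mono fun z hz => contDiffAt_mapInCharts hz.1 hz.2)
          (hcharts.mono fun z hz => injective_fderiv_mapInCharts hz.1 hz.2)

theorem IsRiemannianIsometry.scalarCurvature_eq (hf : IsRiemannianIsometry I g f)
    (hg : IsMetricInCharts I g) {p : M} (hp : f p ∈ (extChartAt I x').source) :
    scalarCurvature I g p = scalarCurvatureOn (inChart I g x') (extChartAt I x' (f p)) := by
  have hleft : (extChartAt I p).symm (extChartAt I p p) = p := extChartAt_to_inv p
  have hcurv := hf.scalarCurvatureOn_inChart hg (mem_extChartAt_target p) (x' := x')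
    (by rwa [hleft])
  rw [mapInCharts, Function.comp_apply, Function.comp_apply, hleft] at hcurv
  exact hcurv

theorem scalarCurvature_eq_scalarCurvatureOn (hg : IsMetricInCharts I g) {p : M}
    (hp : p ∈ (extChartAt I x').source) :
    scalarCurvature I g p = scalarCurvatureOn (inChart I g x') (extChartAt I x' p) :=
  (isRiemannianIsometry_refl g).scalarCurvature_eq hg hp

theorem IsRiemannianIsometry.scalarCurvature_comp (hf : IsRiemannianIsometry I g f)
    (hg : IsMetricInCharts I g) (p : M) : scalarCurvature I g (f p) = scalarCurvature I g p :=
  (hf.scalarCurvature_eq hg (mem_extChartAt_source (f p))).symm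

theorem continuous_scalarCurvature (hg : IsMetricInCharts I g) :
    Continuous (scalarCurvature I g) := by
  rw [continuous_iff_continuousAt]
  intro p
  have hchart : ContinuousAt (fun q => scalarCurvatureOn (inChart I g p) (extChartAt I p q)) p :=
    (continuousAt_scalarCurvatureOn (hg.eventually (mem_extChartAt_target p))).comp
      (continuousAt_extChartAt p)
  refine hchart.congr ?_
  filter_upwards [extChartAt_source_mem_nhds (I := I) p] with q hq
  exact (scalarCurvature_eq_scalarCurvatureOn hg hq).symm

end Transition

/-! ## Curvature 2-forms on surfaces -/

section Curl

variable {E W : Type*} [NormedAddCommGroup E] [NormedSpace ℝ E]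
  [NormedAddCommGroup W] [NormedSpace ℝ W]

theorem oneFormCurl_pullback {β β' : E → E →L[ℝ] W} {Φ : E → E} {y : E}
    (hβ : DifferentiableAt ℝ β (Φ y)) (hΦ : ContDiffAt ℝ ∞ Φ y)
    (h : β' =ᶠ[𝓝 y] fun x => (β (Φ x)) ∘L (fderiv ℝ Φ x)) (u v : E) :
    oneFormCurl β' y u v = oneFormCurl β (Φ y) (fderiv ℝ Φ y u) (fderiv ℝ Φ y v) := by
  have hΦ' : DifferentiableAt ℝ Φ y := hΦ.differentiableAt (by simp)
  have hDΦ : DifferentiableAt ℝ (fderiv ℝ Φ) y :=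
    (hΦ.fderiv_right (m := ∞) (by simp)).differentiableAt (by simp)
  have hβΦ : DifferentiableAt ℝ (fun x => β (Φ x)) y := hβ.comp y hΦ'
  rw [oneFormCurl_apply, oneFormCurl_apply, h.fderiv_eq, fderiv_clm_comp hβΦ hDΦ,
    fderiv_fun_comp y hβ hΦ']
  simp [(isSymmSndFDerivAt_of_contDiffAt_infty hΦ).eq u v]

theorem oneFormCurl_clm_comp {F : Type*} [NormedAddCommGroup F] [NormedSpace ℝ F]
    {β : E → E →L[ℝ] W} {y : E} (hβ : DifferentiableAt ℝ β y) (l : W →L[ℝ] F) (u v : E) :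
    oneFormCurl (fun x => l ∘L β x) y u v = l (oneFormCurl β y u v) := by
  rw [oneFormCurl_apply, oneFormCurl_apply, fderiv_clm_comp (by fun_prop) hβ]
  simp

end Curl

section PlaneForms

variable {V : Type*} [NormedAddCommGroup V] [NormedSpace ℝ V] {b c : V →L[ℝ] V →L[ℝ] ℝ}

theorem alternating_apply_eq_det_mul (hc : ∀ u, c u u = 0) (f : Module.Basis (Fin 2) ℝ V)
    (u : Fin 2 → V) : c (u 0) (u 1) = f.det u * c (f 0) (f 1) := by
  have hskew : c (f 1) (f 0) = -c (f 0) (f 1) := by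
    have hsum := hc (f 0 + f 1)
    simp only [map_add, add_apply, hc] at hsum
    linarith
  have hcoord (i : Fin 2) : u i = f.repr (u i) 0 • f 0 + f.repr (u i) 1 • f 1 := by
    rw [← Fin.sum_univ_two fun j => f.repr (u i) j • f j, f.sum_repr]
  conv_lhs => rw [hcoord 0, hcoord 1]
  simp only [f.det_apply, Matrix.det_fin_two, Module.Basis.toMatrix_apply, map_add, map_smul,
    add_apply, smul_apply, smul_eq_mul, hc, hskew]
  ring

theorem gram_det_eq_sq_det {f : Module.Basis (Fin 2) ℝ V}
    (hf : ∀ i j, b (f i) (f j) = if i = j then 1 else 0) (u : Fin 2 → V) :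
    b (u 0) (u 0) * b (u 1) (u 1) - b (u 0) (u 1) ^ 2 = f.det u ^ 2 := by
  have hu (i j : Fin 2) : b (u i) (u j) = f.repr (u i) 0 * f.repr (u j) 0 +
      f.repr (u i) 1 * f.repr (u j) 1 := by
    conv_lhs => rw [← f.sum_repr (u i), ← f.sum_repr (u j)]
    simp [hf, Fin.sum_univ_two, -Module.Basis.sum_repr]
  rw [hu, hu, hu, f.det_apply, Matrix.det_fin_two]
  simp only [Module.Basis.toMatrix_apply]
  ring

/-- The squared norm of an alternating bilinear form `c` with respect to the scalar product `b`
on the plane, written in the standard basis. -/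
noncomputable def planeFormNormSq
    (b c : EuclideanSpace ℝ (Fin 2) →L[ℝ] EuclideanSpace ℝ (Fin 2) →L[ℝ] ℝ) : ℝ :=
  let e := (EuclideanSpace.basisFun (Fin 2) ℝ).toBasis
  c (e 0) (e 1) ^ 2 / (b (e 0) (e 0) * b (e 1) (e 1) - b (e 0) (e 1) ^ 2)

theorem planeFormNormSq_eq_sq
    {b c : EuclideanSpace ℝ (Fin 2) →L[ℝ] EuclideanSpace ℝ (Fin 2) →L[ℝ] ℝ}
    (hc : ∀ u, c u u = 0) {f : Module.Basis (Fin 2) ℝ (EuclideanSpace ℝ (Fin 2))}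
    (hf : ∀ i j, b (f i) (f j) = if i = j then 1 else 0) :
    planeFormNormSq b c = c (f 0) (f 1) ^ 2 := by
  let e := (EuclideanSpace.basisFun (Fin 2) ℝ).toBasis
  have hdet : f.det e ≠ 0 := (f.isUnit_det e).ne_zero
  rw [planeFormNormSq, gram_det_eq_sq_det hf e, alternating_apply_eq_det_mul hc f e, mul_pow]
  field_simp

theorem continuousAt_planeFormNormSq {X : Type*} [TopologicalSpace X]
    {b c : X → EuclideanSpace ℝ (Fin 2) →L[ℝ] EuclideanSpace ℝ (Fin 2) →L[ℝ] ℝ} {x : X}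
    (hb : ContinuousAt b x) (hc : ContinuousAt c x)
    {f : Module.Basis (Fin 2) ℝ (EuclideanSpace ℝ (Fin 2))}
    (hf : ∀ i j, b x (f i) (f j) = if i = j then 1 else 0) :
    ContinuousAt (fun y => planeFormNormSq (b y) (c y)) x := by
  unfold planeFormNormSq
  refine ContinuousAt.div (by fun_prop) (by fun_prop) ?_
  rw [gram_det_eq_sq_det hf]
  exact pow_ne_zero 2 (f.isUnit_det _).ne_zero

end PlaneForms

section SurfaceForms

variable {N : Type*} [TopologicalSpace N] [ChartedSpace (EuclideanSpace ℝ (Fin 2)) N]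
  {h : ∀ p : N, TangentSpace (𝓡 2) p →L[ℝ] TangentSpace (𝓡 2) p →L[ℝ] ℝ}
  {β β' : ∀ p : N, TangentSpace (𝓡 2) p →L[ℝ] ℝ} {f : N ≃ₘ^∞⟮𝓡 2, 𝓡 2⟯ N}

/-- The squared norm `|dβ|²` of the exterior derivative of a 1-form on a surface. -/
noncomputable def curlNormSq (h : ∀ p : N, TangentSpace (𝓡 2) p →L[ℝ] TangentSpace (𝓡 2) p →L[ℝ] ℝ)
    (β : ∀ p : N, TangentSpace (𝓡 2) p →L[ℝ] ℝ) (p : N) : ℝ :=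
  planeFormNormSq (inChart (𝓡 2) h p (extChartAt (𝓡 2) p p))
    (oneFormCurl (oneFormInChart (𝓡 2) β p) (extChartAt (𝓡 2) p p))

variable [IsManifold (𝓡 2) ∞ N]

theorem IsRiemannianIsometry.planeFormNormSq_mapInCharts (hf : IsRiemannianIsometry (𝓡 2) h f)
    (hh : IsMetricInCharts (𝓡 2) h) (hβ : IsSmoothOneFormInCharts (𝓡 2) β)
    (hβ' : ∀ p X, β' p X = β (f p) (mfderiv (𝓡 2) (𝓡 2) f p X)) {x x' : N}
    {y : EuclideanSpace ℝ (Fin 2)} (hy : y ∈ (extChartAt (𝓡 2) x).target)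
    (hy' : f ((extChartAt (𝓡 2) x).symm y) ∈ (extChartAt (𝓡 2) x').source) :
    planeFormNormSq (inChart (𝓡 2) h x y) (oneFormCurl (oneFormInChart (𝓡 2) β' x) y) =
      planeFormNormSq (inChart (𝓡 2) h x' (mapInCharts (𝓡 2) f x x' y))
        (oneFormCurl (oneFormInChart (𝓡 2) β x') (mapInCharts (𝓡 2) f x x' y)) := by
  have hΦ := contDiffAt_mapInCharts hy hy'
  obtain ⟨e, he⟩ := (hh x y hy).exists_basis_orthonormal finrank_euclideanSpace_fin
  let L := LinearEquiv.ofInjectiveEndo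
    (fderiv ℝ (mapInCharts (𝓡 2) f x x') y).toLinearMap (injective_fderiv_mapInCharts hy hy')
  have hL (i) : e.map L i = fderiv ℝ (mapInCharts (𝓡 2) f x x') y (e i) := by simp [L]
  have hLe (i j) : inChart (𝓡 2) h x' (mapInCharts (𝓡 2) f x x' y) (e.map L i) (e.map L j) =
      if i = j then 1 else 0 := by
    rw [← he i j, hf.inChart_eq hy hy', hL, hL]
    rfl
  have hpull := (eventually_mapInCharts f.continuous hy hy').mono fun z hz =>
    oneFormInChart_comp hβ' hz.1 hz.2
  rw [planeFormNormSq_eq_sq (oneFormCurl_self _ _) he,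
    planeFormNormSq_eq_sq (oneFormCurl_self _ _) hLe, hL, hL,
    oneFormCurl_pullback ((hβ x' _ (mapInCharts_mem_target hy')).differentiableAt (by simp))
      hΦ hpull]

theorem IsRiemannianIsometry.curlNormSq_eq (hf : IsRiemannianIsometry (𝓡 2) h f)
    (hh : IsMetricInCharts (𝓡 2) h) (hβ : IsSmoothOneFormInCharts (𝓡 2) β)
    (hβ' : ∀ p X, β' p X = β (f p) (mfderiv (𝓡 2) (𝓡 2) f p X)) {p x : N}
    (hp : f p ∈ (extChartAt (𝓡 2) x).source) :
    curlNormSq h β' p = planeFormNormSq (inChart (𝓡 2) h x (extChartAt (𝓡 2) x (f p)))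
      (oneFormCurl (oneFormInChart (𝓡 2) β x) (extChartAt (𝓡 2) x (f p))) := by
  have hleft : (extChartAt (𝓡 2) p).symm (extChartAt (𝓡 2) p p) = p := extChartAt_to_inv p
  have hnorm := hf.planeFormNormSq_mapInCharts hh hβ hβ' (mem_extChartAt_target p) (x' := x)
    (by rwa [hleft])
  rw [mapInCharts, Function.comp_apply, Function.comp_apply, hleft] at hnorm
  exact hnorm

theorem IsRiemannianIsometry.curlNormSq_comp (hf : IsRiemannianIsometry (𝓡 2) h f)
    (hh : IsMetricInCharts (𝓡 2) h) (hβ : IsSmoothOneFormInCharts (𝓡 2) β)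
    (hβ' : ∀ p X, β' p X = β (f p) (mfderiv (𝓡 2) (𝓡 2) f p X)) (p : N) :
    curlNormSq h β' p = curlNormSq h β (f p) :=
  hf.curlNormSq_eq hh hβ hβ' (mem_extChartAt_source (f p))

theorem curlNormSq_eq_planeFormNormSq (hh : IsMetricInCharts (𝓡 2) h)
    (hβ : IsSmoothOneFormInCharts (𝓡 2) β) {p x : N} (hp : p ∈ (extChartAt (𝓡 2) x).source) :
    curlNormSq h β p = planeFormNormSq (inChart (𝓡 2) h x (extChartAt (𝓡 2) x p))
      (oneFormCurl (oneFormInChart (𝓡 2) β x) (extChartAt (𝓡 2) x p)) := by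
  refine (isRiemannianIsometry_refl h).curlNormSq_eq hh hβ (fun p X => ?_) hp
  have hid : mfderiv (𝓡 2) (𝓡 2) (Diffeomorph.refl (𝓡 2) N ∞) p = ContinuousLinearMap.id ℝ _ :=
    mfderiv_id
  rw [hid]
  rfl

theorem continuous_curlNormSq (hh : IsMetricInCharts (𝓡 2) h)
    (hβ : IsSmoothOneFormInCharts (𝓡 2) β) : Continuous (curlNormSq h β) := by
  rw [continuous_iff_continuousAt]
  intro p
  have hp := mem_extChartAt_target (I := 𝓡 2) p
  obtain ⟨e, he⟩ := (hh p _ hp).exists_basis_orthonormal finrank_euclideanSpace_fin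
  have hchart := ContinuousAt.comp (f := extChartAt (𝓡 2) p) (x := p)
    (continuousAt_planeFormNormSq (hh p _ hp).smooth.continuousAt
      (contDiffAt_oneFormCurl (hβ p _ hp)).continuousAt he) (continuousAt_extChartAt p)
  refine hchart.congr ?_
  filter_upwards [extChartAt_source_mem_nhds (I := 𝓡 2) p] with q hq
  exact (curlNormSq_eq_planeFormNormSq hh hβ hq).symm

end SurfaceForms

/-! ## Abelian principal bundles -/

section MaurerCartan

variable {V : Type*} [NormedAddCommGroup V] [NormedSpace ℝ V]
  {B : Type*} [TopologicalSpace B] {I : ModelWithCorners ℝ V B}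
  {H : Type*} [TopologicalSpace H] [ChartedSpace B H] [Group H] {x : H} {y : V}

/-- The Maurer–Cartan form of a Lie group, with values in the tangent space at the identity, which
is the model space `V`. -/
noncomputable def maurerCartan (I : ModelWithCorners ℝ V B) (z : H) : TangentSpace I z →L[ℝ] V :=
  (mfderiv I I (fun w : H => z⁻¹ * w) z : V →L[ℝ] V)

/-- The map `(y, y') ↦ z⁻¹ z'`, where `y` and `y'` are the coordinates of `z` and `z'` in the
preferred chart at `x` and the result is read in the preferred chart at the identity. -/
noncomputable def leftDivInChart (I : ModelWithCorners ℝ V B) (x : H) (p : V × V) : V :=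
  extChartAt I (1 : H) (((extChartAt I x).symm p.1)⁻¹ * (extChartAt I x).symm p.2)

variable [LieGroup I ∞ H]

theorem mdifferentiableAt_leftMul (a z : H) : MDifferentiableAt I I (fun w => a * w) z :=
  (contMDiff_mul_left (I := I) (n := ∞)).mdifferentiableAt (by simp)

theorem mdifferentiableAt_inv (z : H) : MDifferentiableAt I I (fun w : H => w⁻¹) z :=
  (contMDiff_inv I ∞).mdifferentiableAt (by simp)

theorem maurerCartan_injective (z : H) : Function.Injective (maurerCartan I z) := by
  have hinv (w : TangentSpace I z) :
      (mfderiv I I (fun w : H => z * w) (z⁻¹ * z) (maurerCartan I z w) : V) = w := by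
    have hcomp := mfderiv_comp_apply z (mdifferentiableAt_leftMul (I := I) z (z⁻¹ * z))
      (mdifferentiableAt_leftMul (I := I) z⁻¹ z) w
    have hid : (fun w : H => z * w) ∘ (fun w => z⁻¹ * w) = id := by ext w; simp
    rw [hid, mfderiv_id] at hcomp
    exact hcomp.symm
  exact Function.LeftInverse.injective (g := fun v : V =>
    (mfderiv I I (fun w : H => z * w) (z⁻¹ * z) v : V)) hinv

theorem mfderiv_mul_one (w : V × V) :
    (mfderiv (I.prod I) I (fun p : H × H => p.1 * p.2) (1, 1) w : V) = w.1 + w.2 := by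
  have hmul : MDifferentiableAt (I.prod I) I (fun p : H × H => p.1 * p.2) (1, 1) :=
    (contMDiff_mul I ∞).mdifferentiableAt (by simp)
  have hfst (v : V) : (mfderiv I I (fun z : H => z * 1) 1 v : V) = v := by
    have hid : (fun z : H => z * 1) = id := by ext; simp
    rw [hid, mfderiv_id]
    rfl
  have hsnd (v : V) : (mfderiv I I (fun z : H => 1 * z) 1 v : V) = v := by
    have hid : (fun z : H => 1 * z) = id := by ext; simp
    rw [hid, mfderiv_id]
    rfl
  exact (mfderiv_prod_eq_add_apply hmul).trans (congrArg₂ (· + ·) (hfst w.1) (hsnd w.2))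

theorem mfderiv_inv_one (v : V) : (mfderiv I I (fun z : H => z⁻¹) 1 v : V) = -v := by
  have hmul : MDifferentiableAt (I.prod I) I (fun p : H × H => p.1 * p.2) (1, 1) :=
    (contMDiff_mul I ∞).mdifferentiableAt (by simp)
  have hid : MDifferentiableAt I I (id : H → H) 1 := mdifferentiableAt_id
  have hinv := mdifferentiableAt_inv (I := I) (1 : H)
  have hcomp := mfderiv_comp_apply_of_eq (1 : H) hmul (hid.prodMk hinv) (by simp) v
  have hone : (fun p : H × H => p.1 * p.2) ∘ (fun z : H => (id z, z⁻¹)) = fun _ => 1 := by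
    ext z
    simp
  rw [hone, mfderiv_const, mfderiv_prodMk hid hinv] at hcomp
  let d : V := mfderiv I I (fun z : H => z⁻¹) 1 v
  have hid_apply : (mfderiv I I (id : H → H) 1 v : V) = v := DFunLike.congr_fun mfderiv_id v
  have hsum : (0 : V) = v + d :=
    (hcomp.trans (mfderiv_mul_one _)).trans (congrArg (fun a : V => a + d) hid_apply)
  exact (neg_eq_of_add_eq_zero_right hsum.symm).symm

variable [I.Boundaryless]

theorem oneFormInChart_maurerCartan_injective (hy : y ∈ (extChartAt I x).target) :
    Function.Injective (oneFormInChart I (maurerCartan I (H := H)) x y) := by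
  have : IsManifold I ∞ H := LieGroup.toContMDiffMul.toIsManifold
  exact (maurerCartan_injective _).comp (injective_mfderiv_extChartAt_symm hy)

theorem contDiffAt_leftDivInChart (hy : y ∈ (extChartAt I x).target) :
    ContDiffAt ℝ ∞ (leftDivInChart I x) (y, y) := by
  have : IsManifold I ∞ H := LieGroup.toContMDiffMul.toIsManifold
  have hsymm := contMDiffAt_extChartAt_symm (I := I) hy
  have hfst := ContMDiffAt.comp (y, y) (f := Prod.fst) hsymm contDiffAt_fst.contMDiffAt
  have hsnd := ContMDiffAt.comp (y, y) (f := Prod.snd) hsymm contDiffAt_snd.contMDiffAt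
  have hchart : ContMDiffAt I 𝓘(ℝ, V) ∞ (extChartAt I (1 : H))
      (((extChartAt I x).symm y)⁻¹ * (extChartAt I x).symm y) := by
    rw [inv_mul_cancel]
    exact contMDiffAt_extChartAt
  exact (hchart.comp (y, y) (hfst.inv.mul hsnd)).contDiffAt

theorem oneFormInChart_maurerCartan (hy : y ∈ (extChartAt I x).target) :
    oneFormInChart I (maurerCartan I) x y =
      fderiv ℝ (leftDivInChart I x) (y, y) ∘L ContinuousLinearMap.inr ℝ V V := by
  have : IsManifold I ∞ H := LieGroup.toContMDiffMul.toIsManifold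
  ext u
  have hpartial : fderiv ℝ (fun w => leftDivInChart I x (y, w)) y u =
      fderiv ℝ (leftDivInChart I x) (y, y) (0, u) := by
    have hd := (contDiffAt_leftDivInChart hy).differentiableAt (by simp)
    exact (DFunLike.congr_fun (hd.hasFDerivAt.comp y
      ((hasFDerivAt_const y y).prodMk (hasFDerivAt_id y))).fderiv u).trans (by simp)
  have hsymm := mdifferentiableAt_extChartAt_symm (I := I) hy
  have hmul := mdifferentiableAt_leftMul (I := I) ((extChartAt I x).symm y)⁻¹
    ((extChartAt I x).symm y)
  have hchart : MDifferentiableAt I 𝓘(ℝ, V) (extChartAt I (1 : H)) 1 :=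
    mdifferentiableAt_extChartAt (mem_chart_source _ _)
  have hcomp := mfderiv_comp_apply_of_eq y hchart (hmul.comp y hsymm)
    (inv_mul_cancel ((extChartAt I x).symm y)) u
  rw [mfderiv_extChartAt_self, mfderiv_eq_fderiv] at hcomp
  exact ((mfderiv_comp_apply y hmul hsymm u).symm.trans hcomp.symm).trans hpartial

theorem isSmoothOneFormInCharts_maurerCartan :
    IsSmoothOneFormInCharts I (maurerCartan I (H := H)) := by
  intro x y hy
  have hdiag : ContDiffAt ℝ ∞ (fun z => fderiv ℝ (leftDivInChart I x) (z, z)) y :=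
    ContDiffAt.comp y (f := fun z => (z, z))
      ((contDiffAt_leftDivInChart hy).fderiv_right (by simp)) (contDiffAt_id.prodMk contDiffAt_id)
  exact (hdiag.clm_comp contDiffAt_const).congr_of_eventuallyEq
    (Filter.mem_of_superset ((isOpen_extChartAt_target x).mem_nhds hy)
      fun z hz => oneFormInChart_maurerCartan hz)

end MaurerCartan

section MaurerCartanClosed

variable {V : Type*} [NormedAddCommGroup V] [NormedSpace ℝ V]
  {B : Type*} [TopologicalSpace B] {I : ModelWithCorners ℝ V B}
  {H : Type*} [TopologicalSpace H] [ChartedSpace B H] [CommGroup H] [LieGroup I ∞ H]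

/-- The map `z ↦ a z⁻¹` of a commutative Lie group. -/
noncomputable def divLeftDiffeomorph (I : ModelWithCorners ℝ V B) [LieGroup I ∞ H] (a : H) :
    H ≃ₘ^∞⟮I, I⟯ H where
  toEquiv := Equiv.divLeft a
  contMDiff_toFun := show ContMDiff I I ∞ fun z : H => a / z from contMDiff_const.div contMDiff_id
  contMDiff_invFun := show ContMDiff I I ∞ fun z : H => z⁻¹ * a from
    (contMDiff_inv I ∞).mul contMDiff_const

theorem divLeftDiffeomorph_apply (a z : H) : divLeftDiffeomorph I a z = a / z := rfl

theorem maurerCartan_divLeft (a z : H) (v : TangentSpace I z) :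
    maurerCartan I (divLeftDiffeomorph I a z)
      (mfderiv I I (divLeftDiffeomorph I a) z v) = -maurerCartan I z v := by
  have hleft := mfderiv_comp_apply z (mdifferentiableAt_leftMul (I := I)
    (divLeftDiffeomorph I a z)⁻¹ (divLeftDiffeomorph I a z))
    ((divLeftDiffeomorph I a).contMDiff.mdifferentiableAt (by simp)) v
  have hright := mfderiv_comp_apply_of_eq z (mdifferentiableAt_inv (I := I) (1 : H))
    (mdifferentiableAt_leftMul (I := I) z⁻¹ z) (by simp) v
  have hcomp : (fun w => (divLeftDiffeomorph I a z)⁻¹ * w) ∘ (divLeftDiffeomorph I a) =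
      (fun w : H => w⁻¹) ∘ (fun w => z⁻¹ * w) := by
    ext w
    simp only [Function.comp_apply, divLeftDiffeomorph_apply, inv_div, mul_inv_rev, inv_inv]
    rw [div_mul_div_cancel, div_eq_mul_inv, mul_comm]
  rw [hcomp] at hleft
  exact (hleft.symm.trans hright).trans (mfderiv_inv_one _)

variable [I.Boundaryless] {x : H} {y : V}

theorem neg_oneFormInChart_maurerCartan (a : H) (hy : y ∈ (extChartAt I x).target)
    (hy' : divLeftDiffeomorph I a ((extChartAt I x).symm y) ∈ (extChartAt I x).source) :
    -oneFormInChart I (maurerCartan I) x y =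
      oneFormInChart I (maurerCartan I) x (mapInCharts I (divLeftDiffeomorph I a) x x y) ∘L
        fderiv ℝ (mapInCharts I (divLeftDiffeomorph I a) x x) y := by
  have : IsManifold I ∞ H := LieGroup.toContMDiffMul.toIsManifold
  exact oneFormInChart_comp (α := maurerCartan I) (α' := fun q => -maurerCartan I q)
    (fun q X => (maurerCartan_divLeft a q X).symm) hy hy'

/- The inversion `z ↦ p² z⁻¹` fixes `p`, pulls the Maurer–Cartan form `θ` back to `-θ` and has
derivative `-1` at `p`. Hence `-dθ = dθ` at `p`. -/
theorem oneFormCurl_maurerCartan (hy : y ∈ (extChartAt I x).target) :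
    oneFormCurl (oneFormInChart I (maurerCartan I (H := H)) x) y = 0 := by
  have : IsManifold I ∞ H := LieGroup.toContMDiffMul.toIsManifold
  set θ := oneFormInChart I (maurerCartan I (H := H)) x
  set p := (extChartAt I x).symm y with hp
  set f := divLeftDiffeomorph I (p * p)
  have hfp : f p = p := mul_div_cancel_right p p
  have hy' : f p ∈ (extChartAt I x).source := by
    rw [hfp]
    exact (extChartAt I x).map_target hy
  have hfix : mapInCharts I f x x y = y := by
    rw [mapInCharts, Function.comp_apply, Function.comp_apply, ← hp, hfp, hp]
    exact (extChartAt I x).right_inv hy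
  have hneg (w : V) : fderiv ℝ (mapInCharts I f x x) y w = -w := by
    have happly := DFunLike.congr_fun (neg_oneFormInChart_maurerCartan (p * p) hy hy') w
    rw [hfix] at happly
    exact oneFormInChart_maurerCartan_injective hy (happly.symm.trans (map_neg _ _).symm)
  ext u v
  have hcurl := oneFormCurl_pullback (β := θ) (β' := -θ)
    (by rw [hfix]; exact (isSmoothOneFormInCharts_maurerCartan x y hy).differentiableAt (by simp))
    (contDiffAt_mapInCharts hy hy')
    ((eventually_mapInCharts f.continuous hy hy').mono fun z hz =>
      neg_oneFormInChart_maurerCartan (p * p) hz.1 hz.2) u v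
  have hcurl_neg : oneFormCurl (-θ) y u v = -oneFormCurl θ y u v := by
    rw [oneFormCurl_apply, oneFormCurl_apply, fderiv_neg, neg_sub', neg_apply, neg_apply, neg_apply,
      neg_apply]
  rw [hfix, hneg, hneg, hcurl_neg, map_neg (oneFormCurl θ y), neg_apply,
    map_neg, neg_neg] at hcurl
  have : IsAddTorsionFree V := .of_isTorsionFree ℝ V
  exact neg_eq_self.mp hcurl

end MaurerCartanClosed

section ProductChart

variable {E : Type*} [NormedAddCommGroup E] [NormedSpace ℝ E]
  {A : Type*} [TopologicalSpace A] {I : ModelWithCorners ℝ E A}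
  {M : Type*} [TopologicalSpace M] [ChartedSpace A M]
  {F : Type*} [NormedAddCommGroup F] [NormedSpace ℝ F]
  {B : Type*} [TopologicalSpace B] {J : ModelWithCorners ℝ F B}
  {M' : Type*} [TopologicalSpace M'] [ChartedSpace B M'] {x : M × M'} {y : E × F}

theorem mem_extChartAt_target_prod : y ∈ (extChartAt (I.prod J) x).target ↔
    y.1 ∈ (extChartAt I x.1).target ∧ y.2 ∈ (extChartAt J x.2).target := by
  rw [extChartAt_prod]
  rfl

theorem mfderiv_extChartAt_symm_prod [I.Boundaryless] [J.Boundaryless] [IsManifold I ∞ M]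
    [IsManifold J ∞ M'] (hy : y ∈ (extChartAt (I.prod J) x).target) (u : E × F) :
    (mfderiv 𝓘(ℝ, E × F) (I.prod J) (extChartAt (I.prod J) x).symm y u : E × F) =
      (mfderiv 𝓘(ℝ, E) I (extChartAt I x.1).symm y.1 u.1,
        mfderiv 𝓘(ℝ, F) J (extChartAt J x.2).symm y.2 u.2) := by
  rw [mem_extChartAt_target_prod] at hy
  have hfst : MDifferentiableAt 𝓘(ℝ, E × F) 𝓘(ℝ, E) Prod.fst y :=
    differentiableAt_fst.mdifferentiableAt
  have hsnd : MDifferentiableAt 𝓘(ℝ, E × F) 𝓘(ℝ, F) Prod.snd y :=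
    differentiableAt_snd.mdifferentiableAt
  have hleft := mdifferentiableAt_extChartAt_symm (I := I) hy.1
  have hright := mdifferentiableAt_extChartAt_symm (I := J) hy.2
  have hfst_apply := mfderiv_comp_apply y hleft hfst u
  have hsnd_apply := mfderiv_comp_apply y hright hsnd u
  rw [mfderiv_eq_fderiv, fderiv_fst] at hfst_apply
  rw [mfderiv_eq_fderiv, fderiv_snd] at hsnd_apply
  exact (DFunLike.congr_fun (mfderiv_prodMk (hleft.comp y hfst) (hright.comp y hsnd)) u).trans
    (Prod.ext hfst_apply hsnd_apply)

end ProductChart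

section BundleMetric

variable {n r : ℕ}
  {N : Type*} [TopologicalSpace N] [ChartedSpace (EuclideanSpace ℝ (Fin n)) N]
  {H : Type*} [TopologicalSpace H] [ChartedSpace (EuclideanSpace ℝ (Fin r)) H] [CommGroup H]
  {h : ∀ p : N, TangentSpace (𝓡 n) p →L[ℝ] TangentSpace (𝓡 n) p →L[ℝ] ℝ}
  {k : ∀ z : H, TangentSpace (𝓡 r) z →L[ℝ] TangentSpace (𝓡 r) z →L[ℝ] ℝ}
  {lam : ∀ p : N, TangentSpace (𝓡 n) p →L[ℝ] GroupLieAlgebra (𝓡 r) H}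

/-- The restriction `⟨·, ·⟩` to the Lie algebra of a field `k` of bilinear forms on a Lie group,
with the Lie algebra identified with the model space. -/
noncomputable def lieAlgebraForm
    (k : ∀ z : H, TangentSpace (𝓡 r) z →L[ℝ] TangentSpace (𝓡 r) z →L[ℝ] ℝ) :
    EuclideanSpace ℝ (Fin r) →L[ℝ] EuclideanSpace ℝ (Fin r) →L[ℝ] ℝ := k 1

theorem connectionForm_apply (q : N × H)
    (ξ : EuclideanSpace ℝ (Fin n) × EuclideanSpace ℝ (Fin r)) :
    let l : EuclideanSpace ℝ (Fin n) →L[ℝ] EuclideanSpace ℝ (Fin r) := lam q.1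
    connectionForm lam q ξ = l ξ.1 + maurerCartan (𝓡 r) q.2 ξ.2 := by
  unfold connectionForm
  rw [mfderiv_fst, mfderiv_snd]
  rfl

theorem inChart_bundleMetric [IsManifold (𝓡 n) ∞ N] [IsManifold (𝓡 r) ∞ H] {x : N × H}
    {y : EuclideanSpace ℝ (Fin n) × EuclideanSpace ℝ (Fin r)}
    (hy : y ∈ (extChartAt ((𝓡 n).prod (𝓡 r)) x).target) :
    inChart ((𝓡 n).prod (𝓡 r)) (bundleMetric h k lam) x y =
      kaluzaKleinMetric (inChart (𝓡 n) h x.1) (lieAlgebraForm k)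
        (oneFormInChart (𝓡 n) (F := EuclideanSpace ℝ (Fin r)) lam x.1)
        (oneFormInChart (𝓡 r) (maurerCartan (𝓡 r)) x.2) y := by
  let b : N × H → EuclideanSpace ℝ (Fin n) × EuclideanSpace ℝ (Fin r) →L[ℝ]
    EuclideanSpace ℝ (Fin n) × EuclideanSpace ℝ (Fin r) →L[ℝ] ℝ := bundleMetric h k lam
  let h' : N → EuclideanSpace ℝ (Fin n) →L[ℝ] EuclideanSpace ℝ (Fin n) →L[ℝ] ℝ := h
  let l : N → EuclideanSpace ℝ (Fin n) →L[ℝ] EuclideanSpace ℝ (Fin r) := lam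
  let m : H → EuclideanSpace ℝ (Fin r) →L[ℝ] EuclideanSpace ℝ (Fin r) := maurerCartan (𝓡 r)
  have hb (q : N × H) (ξ η : EuclideanSpace ℝ (Fin n) × EuclideanSpace ℝ (Fin r)) :
      b q ξ η = h' q.1 ξ.1 η.1 +
        lieAlgebraForm k (l q.1 ξ.1 + m q.2 ξ.2) (l q.1 η.1 + m q.2 η.2) := by
    refine (bundleMetric_apply h k lam q ξ η).trans (congrArg₂ (· + ·) ?_
      (DFunLike.congr (congrArg (lieAlgebraForm k) (connectionForm_apply q ξ))
        (connectionForm_apply q η)))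
    rw [mfderiv_fst]
    rfl
  have hq : (extChartAt ((𝓡 n).prod (𝓡 r)) x).symm y =
      ((extChartAt (𝓡 n) x.1).symm y.1, (extChartAt (𝓡 r) x.2).symm y.2) := by
    rw [extChartAt_prod]
    rfl
  refine ContinuousLinearMap.ext fun u => ContinuousLinearMap.ext fun v => ?_
  exact (DFunLike.congr (DFunLike.congr (congrArg b hq) (mfderiv_extChartAt_symm_prod hy u))
    (mfderiv_extChartAt_symm_prod hy v)).trans (hb _ _ _)

variable [LieGroup (𝓡 r) ∞ H] (hh : IsMetricInCharts (𝓡 n) h)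
  (hsymm : ∀ a b, lieAlgebraForm k a b = lieAlgebraForm k b a)
  (hpos : ∀ a, a ≠ 0 → 0 < lieAlgebraForm k a a)
  (hlam : IsSmoothOneFormInCharts (𝓡 n) (F := EuclideanSpace ℝ (Fin r)) lam)

include hh hsymm hpos hlam

theorem isBundlePoint_inChart {x : N × H}
    {y : EuclideanSpace ℝ (Fin n) × EuclideanSpace ℝ (Fin r)}
    (hy : y ∈ (extChartAt ((𝓡 n).prod (𝓡 r)) x).target) :
    IsBundlePoint (inChart (𝓡 n) h x.1) (lieAlgebraForm k)
      (oneFormInChart (𝓡 n) (F := EuclideanSpace ℝ (Fin r)) lam x.1)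
      (oneFormInChart (𝓡 r) (maurerCartan (𝓡 r)) x.2) y := by
  rw [mem_extChartAt_target_prod] at hy
  exact {
    base := hh x.1 y.1 hy.1
    symm := hsymm
    pos := hpos
    smooth_form := hlam x.1 y.1 hy.1
    smooth_fiber := isSmoothOneFormInCharts_maurerCartan x.2 y.2 hy.2
    injective_fiber := oneFormInChart_maurerCartan_injective hy.2
    closed_fiber := fun a b => sub_eq_zero.mp <|
      DFunLike.congr_fun (DFunLike.congr_fun (oneFormCurl_maurerCartan hy.2) a) b }

variable [IsManifold (𝓡 n) ∞ N]

theorem isMetricInCharts_bundleMetric :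
    IsMetricInCharts ((𝓡 n).prod (𝓡 r)) (bundleMetric h k lam) := by
  have : IsManifold (𝓡 r) ∞ H := LieGroup.toContMDiffMul.toIsManifold
  intro x y hy
  refine (isBundlePoint_inChart hh hsymm hpos hlam hy).isMetricPoint.congr ?_
  filter_upwards [(isOpen_extChartAt_target (I := (𝓡 n).prod (𝓡 r)) x).mem_nhds hy] with z hz
  exact inChart_bundleMetric hz

theorem scalarCurvature_bundleMetric (x : N × H)
    {ι : Type*} [Fintype ι] [DecidableEq ι] {f : Module.Basis ι ℝ (EuclideanSpace ℝ (Fin n))}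
    (hf : ∀ i j, inChart (𝓡 n) h x.1 (extChartAt (𝓡 n) x.1 x.1) (f i) (f j) =
      if i = j then 1 else 0) :
    scalarCurvature ((𝓡 n).prod (𝓡 r)) (bundleMetric h k lam) x =
      scalarCurvature (𝓡 n) h x.1 - 1 / 4 * ∑ i, ∑ j, lieAlgebraForm k
        (oneFormCurl (oneFormInChart (𝓡 n) (F := EuclideanSpace ℝ (Fin r)) lam x.1)
          (extChartAt (𝓡 n) x.1 x.1) (f i) (f j))
        (oneFormCurl (oneFormInChart (𝓡 n) (F := EuclideanSpace ℝ (Fin r)) lam x.1)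
          (extChartAt (𝓡 n) x.1 x.1) (f i) (f j)) := by
  have : IsManifold (𝓡 r) ∞ H := LieGroup.toContMDiffMul.toIsManifold
  have hx := mem_extChartAt_target (I := (𝓡 n).prod (𝓡 r)) x
  have hnhds := (isOpen_extChartAt_target (I := (𝓡 n).prod (𝓡 r)) x).mem_nhds hx
  have hfst : (extChartAt ((𝓡 n).prod (𝓡 r)) x x).1 = extChartAt (𝓡 n) x.1 x.1 := by
    rw [extChartAt_prod]
    rfl
  have hchart := Filter.mem_of_superset hnhds fun z hz =>
    inChart_bundleMetric (h := h) (k := k) (lam := lam) hz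
  have hpoint := Filter.mem_of_superset hnhds fun z hz =>
    isBundlePoint_inChart hh hsymm hpos hlam hz
  rw [scalarCurvature, scalarCurvatureOn_congr hchart
      ((isMetricInCharts_bundleMetric hh hsymm hpos hlam).eventually hx),
    IsBundlePoint.scalarCurvatureOn_kaluzaKleinMetric hpoint (by rw [hfst]; exact hf), hfst]
  rfl

end BundleMetric

section SurfaceBundle

variable {r : ℕ}
  {N : Type*} [TopologicalSpace N] [ChartedSpace (EuclideanSpace ℝ (Fin 2)) N]
  {H : Type*} [TopologicalSpace H] [ChartedSpace (EuclideanSpace ℝ (Fin r)) H] [CommGroup H]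
  {h : ∀ p : N, TangentSpace (𝓡 2) p →L[ℝ] TangentSpace (𝓡 2) p →L[ℝ] ℝ}
  {k : ∀ z : H, TangentSpace (𝓡 r) z →L[ℝ] TangentSpace (𝓡 r) z →L[ℝ] ℝ}
  {lam : ∀ p : N, TangentSpace (𝓡 2) p →L[ℝ] GroupLieAlgebra (𝓡 r) H}

/-- The real-valued 1-form `λ_Z = ⟨λ(·), Z⟩`, with `⟨·, ·⟩` the restriction of `k` to the Lie
algebra. -/
noncomputable def formComponent
    (k : ∀ z : H, TangentSpace (𝓡 r) z →L[ℝ] TangentSpace (𝓡 r) z →L[ℝ] ℝ)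
    (lam : ∀ p : N, TangentSpace (𝓡 2) p →L[ℝ] GroupLieAlgebra (𝓡 r) H)
    (Z : EuclideanSpace ℝ (Fin r)) (p : N) : TangentSpace (𝓡 2) p →L[ℝ] ℝ :=
  let l : TangentSpace (𝓡 2) p →L[ℝ] EuclideanSpace ℝ (Fin r) := lam p
  (lieAlgebraForm k).flip Z ∘L l

theorem oneFormInChart_formComponent (Z : EuclideanSpace ℝ (Fin r)) (x : N) :
    oneFormInChart (𝓡 2) (formComponent k lam Z) x = fun y => (lieAlgebraForm k).flip Z ∘L
      oneFormInChart (𝓡 2) (F := EuclideanSpace ℝ (Fin r)) lam x y := rfl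

variable (hlam : IsSmoothOneFormInCharts (𝓡 2) (F := EuclideanSpace ℝ (Fin r)) lam)

include hlam

theorem isSmoothOneFormInCharts_formComponent (Z : EuclideanSpace ℝ (Fin r)) :
    IsSmoothOneFormInCharts (𝓡 2) (formComponent k lam Z) := fun x y hy => by
  rw [oneFormInChart_formComponent]
  exact contDiffAt_const.clm_comp (hlam x y hy)

theorem exists_fieldStrength [IsManifold (𝓡 2) ∞ N] [LieGroup (𝓡 r) ∞ H]
    (hh : IsMetricInCharts (𝓡 2) h)
    (hsymm : ∀ a b, lieAlgebraForm k a b = lieAlgebraForm k b a)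
    (hpos : ∀ a, a ≠ 0 → 0 < lieAlgebraForm k a a) :
    ∃ v : N → EuclideanSpace ℝ (Fin r),
      (∀ x : N × H, scalarCurvature ((𝓡 2).prod (𝓡 r)) (bundleMetric h k lam) x =
        scalarCurvature (𝓡 2) h x.1 - 1 / 2 * lieAlgebraForm k (v x.1) (v x.1)) ∧
      ∀ Z p, curlNormSq h (formComponent k lam Z) p =
        lieAlgebraForm k (v p) Z ^ 2 := by
  have hframe (p : N) :=
    (hh p _ (mem_extChartAt_target p)).exists_basis_orthonormal finrank_euclideanSpace_fin
  choose e he using hframe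
  let F (p : N) := oneFormCurl (oneFormInChart (𝓡 2) (F := EuclideanSpace ℝ (Fin r)) lam p)
    (extChartAt (𝓡 2) p p)
  refine ⟨fun p => F p (e p 0) (e p 1), fun x => ?_, fun Z p => ?_⟩
  · have hself (u) : F x.1 u u = 0 := oneFormCurl_self _ _ u
    have hswap : F x.1 (e x.1 1) (e x.1 0) = -F x.1 (e x.1 0) (e x.1 1) :=
      oneFormCurl_swap _ _ _ _
    rw [scalarCurvature_bundleMetric hh hsymm hpos hlam x (he x.1)]
    change _ - 1 / 4 * ∑ i, ∑ j, lieAlgebraForm k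
      (F x.1 (e x.1 i) (e x.1 j)) (F x.1 (e x.1 i) (e x.1 j)) = _
    simp only [Fin.sum_univ_two, hself, hswap, map_zero, map_neg, neg_apply]
    ring
  · rw [curlNormSq, planeFormNormSq_eq_sq (oneFormCurl_self _ _) (he p),
      oneFormInChart_formComponent, oneFormCurl_clm_comp
      ((hlam p _ (mem_extChartAt_target p)).differentiableAt (by simp))]
    rfl

end SurfaceBundle

/-! ## The Riemannian measure -/

section Density

variable {V : Type*} [NormedAddCommGroup V] [NormedSpace ℝ V] [FiniteDimensional ℝ V]
  {G G' : V → V →L[ℝ] V →L[ℝ] ℝ} {y y' : V}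

theorem volumeDensity_eq_toMatrix₂ (G : V → V →L[ℝ] V →L[ℝ] ℝ) (y : V) :
    volumeDensity G y = √|(LinearMap.toMatrix₂ (Module.finBasis ℝ V) (Module.finBasis ℝ V)
      (ContinuousLinearMap.toLinearMap₁₂ (G y))).det| := by
  unfold volumeDensity
  congr 3
  ext i j
  rw [Matrix.of_apply, LinearMap.toMatrix₂_apply]
  rfl

theorem volumeDensity_bilinearComp {P : V →L[ℝ] V} (h : G y = (G' y').bilinearComp P P) :
    volumeDensity G y = |P.det| * volumeDensity G' y' := by
  have hcompl : ContinuousLinearMap.toLinearMap₁₂ (G y) =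
      (ContinuousLinearMap.toLinearMap₁₂ (G' y')).compl₁₂ P.toLinearMap P.toLinearMap := by
    rw [h]
    rfl
  rw [volumeDensity_eq_toMatrix₂ G, volumeDensity_eq_toMatrix₂ G', hcompl,
    LinearMap.toMatrix₂_compl₁₂ (Module.finBasis ℝ V) (Module.finBasis ℝ V), Matrix.det_mul,
    Matrix.det_mul, Matrix.det_transpose, LinearMap.det_toMatrix, mul_right_comm, abs_mul, ← sq,
    Real.sqrt_mul (abs_nonneg _), abs_pow, Real.sqrt_sq (abs_nonneg _)]

theorem IsMetricPoint.volumeDensity_pos (hG : IsMetricPoint G y) : 0 < volumeDensity G y := by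
  have hseparating : (ContinuousLinearMap.toLinearMap₁₂ (G y)).SeparatingLeft := fun v hv => by
    by_contra hne
    exact (hG.pos v hne).ne' (hv v)
  rw [← LinearMap.separatingLeft_toMatrix₂_iff (Module.finBasis ℝ V) (Module.finBasis ℝ V),
    Matrix.separatingLeft_iff_det_ne_zero] at hseparating
  rw [volumeDensity_eq_toMatrix₂]
  exact Real.sqrt_pos.mpr (abs_pos.mpr hseparating)

theorem continuousAt_volumeDensity (hG : ContinuousAt G y) : ContinuousAt (volumeDensity G) y := by
  have hdet : Continuous fun b : V →L[ℝ] V →L[ℝ] ℝ =>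
      √|(Matrix.of fun i j => b (Module.finBasis ℝ V i) (Module.finBasis ℝ V j)).det| := by
    refine Real.continuous_sqrt.comp (continuous_abs.comp (Continuous.matrix_det ?_))
    fun_prop
  exact hdet.continuousAt.comp hG

end Density

section Volume

variable {V : Type*} [NormedAddCommGroup V] [NormedSpace ℝ V]
  {B : Type*} [TopologicalSpace B] {I : ModelWithCorners ℝ V B}
  {M : Type*} [TopologicalSpace M] [ChartedSpace B M]
  {g g' : ∀ p : M, TangentSpace I p →L[ℝ] TangentSpace I p →L[ℝ] ℝ}
  {f : M ≃ₘ^∞⟮I, I⟯ M} {x x' : M} {S : Set M}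

theorem isOpen_image_extChartAt_source (f : M ≃ₘ^∞⟮I, I⟯ M) (x : M) :
    IsOpen (f '' (extChartAt I x).source) :=
  f.toHomeomorph.isOpenMap _ (isOpen_extChartAt_source x)

theorem image_mapInCharts (hS : S ⊆ (extChartAt I x').source) :
    mapInCharts I f x x' '' ((extChartAt I x).symm ⁻¹' (f ⁻¹' S) ∩ (extChartAt I x).target) =
      (extChartAt I x').symm ⁻¹' (S ∩ f '' (extChartAt I x).source) ∩
        (extChartAt I x').target := by
  ext z
  constructor
  · rintro ⟨y, hy, rfl⟩
    refine ⟨?_, mapInCharts_mem_target (hS hy.1)⟩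
    rw [mem_preimage, extChartAt_symm_mapInCharts (hS hy.1)]
    exact ⟨hy.1, mem_image_of_mem _ ((extChartAt I x).map_target hy.2)⟩
  · rintro ⟨⟨hzS, q, hq, hqz⟩, hz⟩
    have hleft := (extChartAt I x).left_inv hq
    refine ⟨extChartAt I x q, ⟨?_, (extChartAt I x).map_source hq⟩, ?_⟩
    · rw [mem_preimage, mem_preimage, hleft, hqz]
      exact hzS
    · rw [mapInCharts, Function.comp_apply, Function.comp_apply, hleft, hqz]
      exact (extChartAt I x').right_inv hz

theorem injOn_mapInCharts (hS : S ⊆ (extChartAt I x').source) :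
    InjOn (mapInCharts I f x x')
      ((extChartAt I x).symm ⁻¹' (f ⁻¹' S) ∩ (extChartAt I x).target) := by
  intro y hy z hz hyz
  have hf : f ((extChartAt I x).symm y) = f ((extChartAt I x).symm z) := by
    rw [← extChartAt_symm_mapInCharts (hS hy.1), hyz, extChartAt_symm_mapInCharts (hS hz.1)]
  exact (extChartAt I x).symm.injOn hy.2 hz.2 (f.injective hf)

variable [I.Boundaryless] [MeasurableSpace V] [BorelSpace V] [MeasurableSpace M]

theorem chartVolume_congr [FiniteDimensional ℝ V]
    (h : ∀ y ∈ (extChartAt I x).target,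
    volumeDensity (inChart I g x) y = volumeDensity (inChart I g' x) y) :
    chartVolume I g x = chartVolume I g' x := by
  unfold chartVolume
  congr 1
  refine withDensity_congr_ae ?_
  filter_upwards [ae_restrict_mem (isOpen_extChartAt_target (I := I) x).measurableSet] with y hy
  rw [h y hy]

variable [BorelSpace M]

theorem measurableSet_preimage_extChartAt_symm (x : M) (hS : MeasurableSet S) :
    MeasurableSet ((extChartAt I x).symm ⁻¹' S ∩ (extChartAt I x).target) := by
  have hcont := continuousOn_iff_continuous_domRestrict.mp (continuousOn_extChartAt_symm (I := I) x)
  rw [inter_comm, ← Subtype.image_preimage_coe]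
  exact (isOpen_extChartAt_target x).measurableSet.subtype_image (hcont.measurable hS)

variable [FiniteDimensional ℝ V]

theorem chartVolume_apply (g : ∀ p : M, TangentSpace I p →L[ℝ] TangentSpace I p →L[ℝ] ℝ) (x : M)
    (hS : MeasurableSet S) :
    chartVolume I g x S = ∫⁻ y in (extChartAt I x).symm ⁻¹' S ∩ (extChartAt I x).target,
      ENNReal.ofReal (volumeDensity (inChart I g x) y) ∂(Module.finBasis ℝ V).addHaar := by
  have htarget := (isOpen_extChartAt_target (I := I) x).measurableSet
  rw [chartVolume, Measure.map_apply_of_aemeasurable _ hS, withDensity_apply',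
    Measure.restrict_restrict' htarget]
  exact ((continuousOn_extChartAt_symm x).aemeasurable htarget).mono_ac
    (withDensity_absolutelyContinuous _ _)

variable [IsManifold I ∞ M]

theorem IsRiemannianIsometry.chartVolume_preimage (hf : IsRiemannianIsometry I g f)
    (hSm : MeasurableSet S) (hS : S ⊆ (extChartAt I x').source) :
    chartVolume I g x (f ⁻¹' S) = chartVolume I g x' (S ∩ f '' (extChartAt I x).source) := by
  have hfS : MeasurableSet (f ⁻¹' S) := f.continuous.measurable hSm
  have hD := measurableSet_preimage_extChartAt_symm (I := I) x hfS
  rw [chartVolume_apply g x hfS,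
    chartVolume_apply g x' (hSm.inter (isOpen_image_extChartAt_source f x).measurableSet),
    ← image_mapInCharts hS, lintegral_image_eq_lintegral_abs_det_fderiv_mul _ hD
      (fun y hy => ((contDiffAt_mapInCharts hy.2 (hS hy.1)).differentiableAt
        (by simp)).hasFDerivAt.hasFDerivWithinAt) (injOn_mapInCharts hS)]
  refine setLIntegral_congr_fun hD fun y hy => ?_
  rw [← ENNReal.ofReal_mul (abs_nonneg _),
    volumeDensity_bilinearComp (hf.inChart_eq hy.2 (hS hy.1))]

theorem chartVolume_le_of_subset (hSm : MeasurableSet S) (hS : S ⊆ (extChartAt I x').source) :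
    chartVolume I g x S ≤ chartVolume I g x' S :=
  ((isRiemannianIsometry_refl g).chartVolume_preimage hSm hS).trans_le
    (measure_mono inter_subset_left)

theorem riemannianVolume_apply_of_subset (hSm : MeasurableSet S)
    (hS : S ⊆ (extChartAt I x').source) : riemannianVolume I g S = chartVolume I g x' S := by
  refine le_antisymm ?_ (le_iSup (chartVolume I g) x' S)
  have hsource := (isOpen_extChartAt_source (I := I) x').measurableSet
  have hle : riemannianVolume I g ≤ chartVolume I g x' +
      (riemannianVolume I g).restrict (extChartAt I x').sourceᶜ := by
    refine iSup_le fun x => Measure.le_iff.mpr fun C hC => ?_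
    rw [← measure_inter_add_sdiff C hsource, Measure.add_apply, Measure.restrict_apply hC]
    refine add_le_add ?_ (le_iSup (chartVolume I g) x _)
    exact (chartVolume_le_of_subset (hC.inter hsource) inter_subset_right).trans
      (measure_mono inter_subset_left)
  refine (hle S).trans_eq ?_
  rw [Measure.add_apply, Measure.restrict_apply hSm, ← sdiff_eq, sdiff_eq_empty.mpr hS,
    measure_empty, add_zero]

theorem IsRiemannianIsometry.riemannianVolume_preimage_of_subset (hf : IsRiemannianIsometry I g f)
    (hSm : MeasurableSet S)
    (hS : S ⊆ (extChartAt I x').source ∩ f '' (extChartAt I x).source) :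
    riemannianVolume I g (f ⁻¹' S) = riemannianVolume I g S := by
  have hpreimage : f ⁻¹' S ⊆ (extChartAt I x).source :=
    (preimage_mono (hS.trans inter_subset_right)).trans (preimage_image_eq _ f.injective).subset
  rw [riemannianVolume_apply_of_subset (f.continuous.measurable hSm) hpreimage,
    hf.chartVolume_preimage hSm (hS.trans inter_subset_left),
    inter_eq_self_of_subset_left (hS.trans inter_subset_right),
    riemannianVolume_apply_of_subset hSm (hS.trans inter_subset_left)]

theorem IsRiemannianIsometry.map_riemannianVolume [SigmaCompactSpace M]
    (hf : IsRiemannianIsometry I g f) : (riemannianVolume I g).map f = riemannianVolume I g := by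
  obtain ⟨s, hs, hsU⟩ := countable_cover_nhds_of_sigmaCompact
    (fun x : M => extChartAt_source_mem_nhds (I := I) x)
  have : Countable s := hs.to_subtype
  have hcover : ⋃ i : s × s, (extChartAt I (i.1 : M)).source ∩
      f '' (extChartAt I (i.2 : M)).source = univ := by
    rw [eq_univ_iff_forall] at hsU ⊢
    intro p
    obtain ⟨a, ha, hpa⟩ := mem_iUnion₂.mp (hsU p)
    obtain ⟨b, hb, hpb⟩ := mem_iUnion₂.mp (hsU (f.symm p))
    exact mem_iUnion.mpr ⟨(⟨a, ha⟩, ⟨b, hb⟩), hpa, _, hpb, f.apply_symm_apply p⟩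
  refine Measure.ext_of_iUnion_eq_univ hcover fun i => Measure.ext fun S hS => ?_
  have hSi := hS.inter ((isOpen_extChartAt_source (I := I) (i.1 : M)).inter
    (isOpen_image_extChartAt_source f (i.2 : M))).measurableSet
  rw [Measure.restrict_apply hS, Measure.restrict_apply hS,
    Measure.map_apply f.continuous.measurable hSi]
  exact hf.riemannianVolume_preimage_of_subset hSi inter_subset_right

theorem IsMetricInCharts.isLocallyFiniteMeasure_riemannianVolume (hg : IsMetricInCharts I g) :
    IsLocallyFiniteMeasure (riemannianVolume I g) := by
  refine ⟨fun p => ?_⟩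
  have hdensity := continuousAt_volumeDensity
    (hg p _ (mem_extChartAt_target p)).smooth.continuousAt
  obtain ⟨U, hU, hUfin⟩ := (Module.finBasis ℝ V).addHaar.finiteAt_nhds (extChartAt I p p)
  obtain ⟨W, hW, hWo, hpW⟩ := mem_nhds_iff.mp (Filter.inter_mem hU
    (hdensity.eventually (Iio_mem_nhds (lt_add_one _))))
  have hopen := (continuousOn_extChartAt (I := I) p).isOpen_inter_preimage
    (isOpen_extChartAt_source p) hWo
  refine ⟨_, hopen.mem_nhds ⟨mem_extChartAt_source p, hpW⟩, ?_⟩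
  have hsub : (extChartAt I p).symm ⁻¹' ((extChartAt I p).source ∩ extChartAt I p ⁻¹' W) ∩
      (extChartAt I p).target ⊆ W := by
    rintro y ⟨⟨-, hy⟩, hytarget⟩
    rwa [mem_preimage, (extChartAt I p).right_inv hytarget] at hy
  rw [riemannianVolume_apply_of_subset hopen.measurableSet inter_subset_left,
    chartVolume_apply _ _ hopen.measurableSet]
  calc ∫⁻ y in (extChartAt I p).symm ⁻¹' ((extChartAt I p).source ∩ extChartAt I p ⁻¹' W) ∩
        (extChartAt I p).target, ENNReal.ofReal (volumeDensity (inChart I g p) y)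
          ∂(Module.finBasis ℝ V).addHaar
      ≤ ∫⁻ y in W, ENNReal.ofReal (volumeDensity (inChart I g p) y)
          ∂(Module.finBasis ℝ V).addHaar := lintegral_mono_set hsub
    _ ≤ ∫⁻ _ in W, ENNReal.ofReal (volumeDensity (inChart I g p) (extChartAt I p p) + 1)
          ∂(Module.finBasis ℝ V).addHaar :=
        setLIntegral_mono' hWo.measurableSet fun y hy => ENNReal.ofReal_le_ofReal (hW hy).2.le
    _ = ENNReal.ofReal (volumeDensity (inChart I g p) (extChartAt I p p) + 1) *
          (Module.finBasis ℝ V).addHaar W := setLIntegral_const _ _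
    _ < ⊤ := ENNReal.mul_lt_top ENNReal.ofReal_lt_top
        ((measure_mono fun y hy => (hW hy).1).trans_lt hUfin)

theorem IsMetricInCharts.isOpenPosMeasure_riemannianVolume (hg : IsMetricInCharts I g) :
    (riemannianVolume I g).IsOpenPosMeasure := by
  refine ⟨fun U hU ⟨p, hp⟩ => ?_⟩
  have htarget := mem_extChartAt_target (I := I) p
  have hpos := (hg p _ htarget).volumeDensity_pos
  have hdensity := continuousAt_volumeDensity (hg p _ htarget).smooth.continuousAt
  have hUchart : (extChartAt I p).symm ⁻¹' U ∈ 𝓝 (extChartAt I p p) := by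
    refine (contMDiffAt_extChartAt_symm htarget).continuousAt.preimage_mem_nhds ?_
    rw [extChartAt_to_inv]
    exact hU.mem_nhds hp
  obtain ⟨W, hW, hWo, hpW⟩ := mem_nhds_iff.mp (Filter.inter_mem (Filter.inter_mem hUchart
    ((isOpen_extChartAt_target (I := I) p).mem_nhds htarget))
      (hdensity.eventually (lt_mem_nhds (half_lt_self hpos))))
  refine ne_of_gt ?_
  calc 0 < ENNReal.ofReal (volumeDensity (inChart I g p) (extChartAt I p p) / 2) *
        (Module.finBasis ℝ V).addHaar W :=
        ENNReal.mul_pos (ENNReal.ofReal_pos.mpr (half_pos hpos)).ne'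
          (hWo.measure_ne_zero _ ⟨_, hpW⟩)
    _ = ∫⁻ _ in W, ENNReal.ofReal (volumeDensity (inChart I g p) (extChartAt I p p) / 2)
          ∂(Module.finBasis ℝ V).addHaar := (setLIntegral_const _ _).symm
    _ ≤ ∫⁻ y in W, ENNReal.ofReal (volumeDensity (inChart I g p) y)
          ∂(Module.finBasis ℝ V).addHaar :=
        setLIntegral_mono' hWo.measurableSet fun y hy =>
          ENNReal.ofReal_le_ofReal (le_of_lt (hW hy).2)
    _ ≤ ∫⁻ y in (extChartAt I p).symm ⁻¹' U ∩ (extChartAt I p).target,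
          ENNReal.ofReal (volumeDensity (inChart I g p) y) ∂(Module.finBasis ℝ V).addHaar :=
        lintegral_mono_set fun y hy => (hW hy).1
    _ = chartVolume I g p U := (chartVolume_apply g p hU.measurableSet).symm
    _ ≤ riemannianVolume I g U := le_iSup (chartVolume I g) p U

end Volume

section Shear

theorem abs_det_shear {E F : Type*} [AddCommGroup E] [Module ℝ E] [AddCommGroup F] [Module ℝ F]
    (a : E →ₗ[ℝ] F) :
    |LinearMap.det (LinearMap.fst ℝ E F |>.prod (a.coprod LinearMap.id))| = 1 := by
  let S (b : E →ₗ[ℝ] F) : E × F →ₗ[ℝ] E × F := LinearMap.fst ℝ E F |>.prod (b.coprod LinearMap.id)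
  have hinv : S (-a) * S a = 1 := by
    ext v <;> simp [S]
  have hconj : LinearMap.det (S (-a)) = LinearMap.det (S a) := by
    rw [← LinearMap.det_conj (S a) ((LinearEquiv.refl ℝ E).prodCongr (LinearEquiv.neg ℝ))]
    congr 1
    ext v <;> simp [S]
  have hsq : LinearMap.det (S a) ^ 2 = 1 := by
    rw [sq]
    nth_rw 1 [← hconj]
    rw [← map_mul, hinv, map_one]
  exact (pow_eq_one_iff_of_nonneg (abs_nonneg _) two_ne_zero).mp (by rw [sq_abs, hsq])

theorem abs_det_bundleFrame {E F : Type*} [NormedAddCommGroup E] [NormedSpace ℝ E]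
    [NormedAddCommGroup F] [NormedSpace ℝ F]
    (α : E → E →L[ℝ] F) (θ : F → F →L[ℝ] F) (y : E × F) :
    |(bundleFrame α θ y).det| = |(bundleFrame 0 θ y).det| := by
  have hshear : (bundleFrame α θ y).toLinearMap =
      (LinearMap.fst ℝ E F |>.prod ((α y.1).toLinearMap.coprod LinearMap.id)) *
        (bundleFrame 0 θ y).toLinearMap := by
    ext v <;> simp [bundleFrame_apply]
  rw [ContinuousLinearMap.det, hshear, map_mul, abs_mul, abs_det_shear, one_mul]

end Shear

section BundleVolume

variable {n r : ℕ}
  {N : Type*} [TopologicalSpace N] [ChartedSpace (EuclideanSpace ℝ (Fin n)) N]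
  {H : Type*} [TopologicalSpace H] [ChartedSpace (EuclideanSpace ℝ (Fin r)) H] [CommGroup H]
  (h : ∀ p : N, TangentSpace (𝓡 n) p →L[ℝ] TangentSpace (𝓡 n) p →L[ℝ] ℝ)
  (k : ∀ z : H, TangentSpace (𝓡 r) z →L[ℝ] TangentSpace (𝓡 r) z →L[ℝ] ℝ)
  (lam lam' : ∀ p : N, TangentSpace (𝓡 n) p →L[ℝ] GroupLieAlgebra (𝓡 r) H)

theorem riemannianVolume_bundleMetric_eq [IsManifold (𝓡 n) ∞ N] [IsManifold (𝓡 r) ∞ H]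
    [MeasurableSpace N] [MeasurableSpace H] [BorelSpace (N × H)] :
    riemannianVolume ((𝓡 n).prod (𝓡 r)) (bundleMetric h k lam) =
      riemannianVolume ((𝓡 n).prod (𝓡 r)) (bundleMetric h k lam') := by
  refine iSup_congr fun x => chartVolume_congr fun y hy => ?_
  have hdensity (l : ∀ p : N, TangentSpace (𝓡 n) p →L[ℝ] GroupLieAlgebra (𝓡 r) H) :
      volumeDensity (inChart ((𝓡 n).prod (𝓡 r)) (bundleMetric h k l) x) y =
        |(bundleFrame 0 (oneFormInChart (𝓡 r) (maurerCartan (𝓡 r)) x.2) y).det| *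
          volumeDensity (sumMetric (inChart (𝓡 n) h x.1) (lieAlgebraForm k)) y := by
    rw [volumeDensity_bilinearComp (inChart_bundleMetric hy), abs_det_bundleFrame]
  rw [hdensity lam, hdensity lam']

variable {h}

theorem IsRiemannianIsometry.prodCongr_refl {f : N ≃ₘ^∞⟮𝓡 n, 𝓡 n⟯ N}
    (hf : IsRiemannianIsometry (𝓡 n) h f) :
    IsRiemannianIsometry ((𝓡 n).prod (𝓡 r)) (bundleMetric h k
      (0 : ∀ p : N, TangentSpace (𝓡 n) p →L[ℝ] GroupLieAlgebra (𝓡 r) H))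
      (f.prodCongr (Diffeomorph.refl (𝓡 r) H ∞)) := by
  intro q X Y
  set F := f.prodCongr (Diffeomorph.refl (𝓡 r) H ∞)
  have hF : MDifferentiableAt ((𝓡 n).prod (𝓡 r)) ((𝓡 n).prod (𝓡 r)) F q :=
    (F.contMDiff q).mdifferentiableAt (by simp)
  have hfst (X : TangentSpace ((𝓡 n).prod (𝓡 r)) q) :
      mfderiv ((𝓡 n).prod (𝓡 r)) (𝓡 n) (Prod.fst : N × H → N) (F q)
        (mfderiv ((𝓡 n).prod (𝓡 r)) ((𝓡 n).prod (𝓡 r)) F q X) =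
      mfderiv (𝓡 n) (𝓡 n) f q.1 (mfderiv ((𝓡 n).prod (𝓡 r)) (𝓡 n) (Prod.fst : N × H → N) q X) :=
    (mfderiv_comp_apply q mdifferentiableAt_fst hF X).symm.trans
      (mfderiv_comp_apply q ((f.contMDiff q.1).mdifferentiableAt (by simp))
        mdifferentiableAt_fst X)
  have hsnd (X : TangentSpace ((𝓡 n).prod (𝓡 r)) q) :
      mfderiv ((𝓡 n).prod (𝓡 r)) (𝓡 r) (Prod.snd : N × H → H) (F q)
        (mfderiv ((𝓡 n).prod (𝓡 r)) ((𝓡 n).prod (𝓡 r)) F q X) =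
      mfderiv ((𝓡 n).prod (𝓡 r)) (𝓡 r) (Prod.snd : N × H → H) q X :=
    (mfderiv_comp_apply q mdifferentiableAt_snd hF X).symm
  have hconn (q : N × H) (ξ : TangentSpace ((𝓡 n).prod (𝓡 r)) q) :
      connectionForm (0 : ∀ p : N, TangentSpace (𝓡 n) p →L[ℝ] GroupLieAlgebra (𝓡 r) H) q ξ =
        maurerCartan (𝓡 r) q.2
          (mfderiv ((𝓡 n).prod (𝓡 r)) (𝓡 r) (Prod.snd : N × H → H) q ξ) :=
    zero_add (_ : EuclideanSpace ℝ (Fin r))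
  rw [bundleMetric_apply, bundleMetric_apply, hconn, hconn, hconn, hconn, hfst, hfst, hsnd, hsnd]
  congr 1
  exact hf q.1 _ _

theorem IsRiemannianIsometry.map_riemannianVolume_bundleMetric [IsManifold (𝓡 n) ∞ N]
    [IsManifold (𝓡 r) ∞ H] [SigmaCompactSpace (N × H)]
    [MeasurableSpace N] [MeasurableSpace H] [BorelSpace (N × H)] {f : N ≃ₘ^∞⟮𝓡 n, 𝓡 n⟯ N}
    (hf : IsRiemannianIsometry (𝓡 n) h f) :
    (riemannianVolume ((𝓡 n).prod (𝓡 r)) (bundleMetric h k lam)).map (Prod.map f id) =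
      riemannianVolume ((𝓡 n).prod (𝓡 r)) (bundleMetric h k lam) := by
  rw [riemannianVolume_bundleMetric_eq h k lam 0]
  exact (IsRiemannianIsometry.prodCongr_refl k hf).map_riemannianVolume

end BundleVolume

/-! ## Scalar curvature of torus bundles over surfaces -/

section Coordinates

open scoped RealInnerProductSpace

theorem exists_orthonormal_coordinates {r : ℕ} {V : Type*} [NormedAddCommGroup V]
    [NormedSpace ℝ V] [FiniteDimensional ℝ V] (hr : Module.finrank ℝ V = r)
    {b : V →L[ℝ] V →L[ℝ] ℝ} (hsymm : ∀ u v, b u v = b v u) (hpos : ∀ v, v ≠ 0 → 0 < b v v) :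
    ∃ (L : V → EuclideanSpace ℝ (Fin r)) (Z : EuclideanSpace ℝ (Fin r) → V),
      (∀ v, ‖L v‖ ^ 2 = b v v) ∧ ∀ v c, ⟪L v, c⟫ = b v (Z c) := by
  obtain ⟨e, he⟩ := exists_basis_orthonormal_of_pos
    (b := ContinuousLinearMap.toLinearMap₁₂ b) hsymm hpos hr
  refine ⟨fun v => WithLp.toLp 2 fun i => b v (e i), fun c => ∑ i, c i • e i, fun v => ?_,
    fun v c => ?_⟩
  · rw [EuclideanSpace.norm_sq_eq, ← sum_sq_of_orthonormal he v]
    simp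
  · rw [PiLp.inner_apply, map_sum]
    simp

end Coordinates

section TorusBundle

variable {r : ℕ}
  {N : Type*} [TopologicalSpace N] [ChartedSpace (EuclideanSpace ℝ (Fin 2)) N]
  [IsManifold (𝓡 2) ∞ N] [CompactSpace N] [T2Space N] [MeasurableSpace N] [BorelSpace N]
  {H : Type*} [TopologicalSpace H] [ChartedSpace (EuclideanSpace ℝ (Fin r)) H] [CommGroup H]
  [LieGroup (𝓡 r) ∞ H] [CompactSpace H] [MeasurableSpace H] [BorelSpace H]

theorem integral_scalarCurvature_bundleMetric_pow_eq
    {h : ∀ p : N, TangentSpace (𝓡 2) p →L[ℝ] TangentSpace (𝓡 2) p →L[ℝ] ℝ}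
    {k : ∀ z : H, TangentSpace (𝓡 r) z →L[ℝ] TangentSpace (𝓡 r) z →L[ℝ] ℝ}
    {lam lam' : ∀ p : N, TangentSpace (𝓡 2) p →L[ℝ] GroupLieAlgebra (𝓡 r) H}
    (hh : IsMetricInCharts (𝓡 2) h)
    (hsymm : ∀ a b, lieAlgebraForm k a b = lieAlgebraForm k b a)
    (hpos : ∀ a, a ≠ 0 → 0 < lieAlgebraForm k a a)
    (hlam : IsSmoothOneFormInCharts (𝓡 2) (F := EuclideanSpace ℝ (Fin r)) lam)
    (hlam' : IsSmoothOneFormInCharts (𝓡 2) (F := EuclideanSpace ℝ (Fin r)) lam')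
    (hiso : ∀ Z, ∃ f : N ≃ₘ^∞⟮𝓡 2, 𝓡 2⟯ N, IsRiemannianIsometry (𝓡 2) h f ∧
      ∀ p X, formComponent k lam' Z p X =
        formComponent k lam Z (f p) (mfderiv (𝓡 2) (𝓡 2) f p X)) (j : ℕ) :
    ∫ q, scalarCurvature ((𝓡 2).prod (𝓡 r)) (bundleMetric h k lam) q ^ j
        ∂riemannianVolume ((𝓡 2).prod (𝓡 r)) (bundleMetric h k lam) =
      ∫ q, scalarCurvature ((𝓡 2).prod (𝓡 r)) (bundleMetric h k lam') q ^ j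
        ∂riemannianVolume ((𝓡 2).prod (𝓡 r)) (bundleMetric h k lam) := by
  have : IsManifold (𝓡 r) ∞ H := LieGroup.toContMDiffMul.toIsManifold
  have : IsTopologicalGroup H := topologicalGroup_of_lieGroup (𝓡 r) ∞
  have := ChartedSpace.secondCountable_of_sigmaCompact (EuclideanSpace ℝ (Fin 2)) N
  have := (isMetricInCharts_bundleMetric hh hsymm hpos
    hlam).isLocallyFiniteMeasure_riemannianVolume
  obtain ⟨v, hv, hvcurl⟩ := exists_fieldStrength hlam hh hsymm hpos
  obtain ⟨v', hv', hvcurl'⟩ := exists_fieldStrength hlam' hh hsymm hpos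
  obtain ⟨L, Z, hL, hLZ⟩ := exists_orthonormal_coordinates finrank_euclideanSpace_fin hsymm hpos
  have hcont (Z) := continuous_curlNormSq hh
    (isSmoothOneFormInCharts_formComponent (k := k) hlam Z)
  have hcont' (Z) := continuous_curlNormSq hh
    (isSmoothOneFormInCharts_formComponent (k := k) hlam' Z)
  simp only [hv, hv', ← hL]
  refine integral_sub_norm_sq_pow_eq ((continuous_scalarCurvature hh).comp continuous_fst)
    (w := fun q => L (v q.1)) (w' := fun q => L (v' q.1)) (fun c => ?_) (fun c => ?_)
    (fun c => ?_) (1 / 2) j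
  · simp only [hLZ, ← hvcurl]
    exact (hcont _).comp continuous_fst
  · simp only [hLZ, ← hvcurl']
    exact (hcont' _).comp continuous_fst
  · obtain ⟨f, hf, hpullback⟩ := hiso (Z c)
    refine ⟨Prod.map f id, ⟨(f.continuous.prodMap continuous_id).measurable,
      hf.map_riemannianVolume_bundleMetric k lam⟩, fun q => hf.scalarCurvature_comp hh q.1,
      fun q => ?_⟩
    rw [hLZ, hLZ, ← hvcurl, ← hvcurl']
    exact hf.curlNormSq_comp hh (isSmoothOneFormInCharts_formComponent hlam (Z c)) hpullback q.1

theorem theorem2p11_general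
    (h : ContMDiffRiemannianMetric (𝓡 2) ∞ (EuclideanSpace ℝ (Fin 2))
      (fun p : N => TangentSpace (𝓡 2) p))
    (k : ∀ z : H, TangentSpace (𝓡 r) z →L[ℝ] TangentSpace (𝓡 r) z →L[ℝ] ℝ)
    (hsymm : ∀ a b, lieAlgebraForm k a b = lieAlgebraForm k b a)
    (hpos : ∀ a, a ≠ 0 → 0 < lieAlgebraForm k a a)
    (lam lam' : ∀ p : N, TangentSpace (𝓡 2) p →L[ℝ] GroupLieAlgebra (𝓡 r) H)
    (hlam : IsSmoothOneForm (𝓡 2) (F := EuclideanSpace ℝ (Fin r)) lam)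
    (hlam' : IsSmoothOneForm (𝓡 2) (F := EuclideanSpace ℝ (Fin r)) lam')
    (hiso : ∀ Z, ∃ f : N ≃ₘ^∞⟮𝓡 2, 𝓡 2⟯ N, IsRiemannianIsometry (𝓡 2) h.inner f ∧
      ∀ p X, formComponent k lam' Z p X =
        formComponent k lam Z (f p) (mfderiv (𝓡 2) (𝓡 2) f p X)) :
    let I := (𝓡 2).prod (𝓡 r)
    let g : ∀ q : N × H, TangentSpace I q →L[ℝ] TangentSpace I q →L[ℝ] ℝ :=
      bundleMetric h.inner k lam
    let g' : ∀ q : N × H, TangentSpace I q →L[ℝ] TangentSpace I q →L[ℝ] ℝ :=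
      bundleMetric h.inner k lam'
    (∀ j : ℕ,
      Integrable (fun q => scalarCurvature I g q ^ j) (riemannianVolume I g) ∧
      Integrable (fun q => scalarCurvature I g' q ^ j) (riemannianVolume I g') ∧
      ∫ q, scalarCurvature I g q ^ j ∂(riemannianVolume I g) =
        ∫ q, scalarCurvature I g' q ^ j ∂(riemannianVolume I g')) ∧
    range (scalarCurvature I g) = range (scalarCurvature I g') := by
  intro I g g'
  have : IsManifold (𝓡 r) ∞ H := LieGroup.toContMDiffMul.toIsManifold
  have := ChartedSpace.secondCountable_of_sigmaCompact (EuclideanSpace ℝ (Fin 2)) N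
  have hh := isMetricInCharts_inner h
  have hlam := hlam.isSmoothOneFormInCharts
  have hlam' := hlam'.isSmoothOneFormInCharts
  have hg : IsMetricInCharts I g := isMetricInCharts_bundleMetric hh hsymm hpos hlam
  have hg' : IsMetricInCharts I g' := isMetricInCharts_bundleMetric hh hsymm hpos hlam'
  have hvol : riemannianVolume I g' = riemannianVolume I g :=
    riemannianVolume_bundleMetric_eq h.inner k lam' lam
  have := hg.isLocallyFiniteMeasure_riemannianVolume
  have := hg.isOpenPosMeasure_riemannianVolume
  have hs := continuous_scalarCurvature hg
  have hs' := continuous_scalarCurvature hg'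
  have hmoments (j : ℕ) : ∫ q, scalarCurvature I g q ^ j ∂(riemannianVolume I g) =
      ∫ q, scalarCurvature I g' q ^ j ∂(riemannianVolume I g) :=
    integral_scalarCurvature_bundleMetric_pow_eq hh hsymm hpos hlam hlam' hiso j
  rw [hvol]
  exact ⟨fun j => ⟨integrable_of_continuous_of_compactSpace (hs.pow j),
    integrable_of_continuous_of_compactSpace (hs'.pow j), hmoments j⟩,
    range_eq_of_integral_pow_eq hs hs' hmoments⟩

end TorusBundle

theorem theorem2p11 {r : ℕ}
    -- the closed surface `(N, h)`
    {N : Type*} [TopologicalSpace N] [ChartedSpace (EuclideanSpace ℝ (Fin 2)) N]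
    [IsManifold (𝓡 2) ∞ N] [CompactSpace N] [T2Space N] [MeasurableSpace N] [BorelSpace N]
    (h : ContMDiffRiemannianMetric (𝓡 2) ∞ (EuclideanSpace ℝ (Fin 2))
      (fun p : N => TangentSpace (𝓡 2) p))
    -- the torus `H` with its invariant metric `k`
    {H : Type*} [TopologicalSpace H] [ChartedSpace (EuclideanSpace ℝ (Fin r)) H] [CommGroup H]
    [LieGroup (𝓡 r) ∞ H] [CompactSpace H] [T2Space H] [ConnectedSpace H]
    [MeasurableSpace H] [BorelSpace H]
    (k : ContMDiffRiemannianMetric (𝓡 r) ∞ (EuclideanSpace ℝ (Fin r))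
      (fun z : H => TangentSpace (𝓡 r) z))
    (hk : IsLeftInvariantMetric (𝓡 r) k.inner)
    -- the two smooth 1-forms on `N` with values in the Lie algebra of `H`
    (lam lam' : ∀ p : N, TangentSpace (𝓡 2) p →L[ℝ] GroupLieAlgebra (𝓡 r) H)
    (hlam : IsSmoothOneForm (𝓡 2) (F := EuclideanSpace ℝ (Fin r)) lam)
    (hlam' : IsSmoothOneForm (𝓡 2) (F := EuclideanSpace ℝ (Fin r)) lam')
    -- for every `Z` in the Lie algebra, `λ'_Z` is the pullback of `λ_Z` by some isometry
    (hiso : ∀ Z : GroupLieAlgebra (𝓡 r) H, ∃ f : N ≃ₘ^∞⟮𝓡 2, 𝓡 2⟯ N,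
      IsRiemannianIsometry (𝓡 2) h.inner f ∧
      ∀ (p : N) (X : TangentSpace (𝓡 2) p),
        k.inner 1 (lam' p X) Z = k.inner 1 (lam (f p) (mfderiv (𝓡 2) (𝓡 2) f p X)) Z) :
    let I := (𝓡 2).prod (𝓡 r)
    let g : ∀ q : N × H, TangentSpace I q →L[ℝ] TangentSpace I q →L[ℝ] ℝ :=
      bundleMetric h.inner k.inner lam
    let g' : ∀ q : N × H, TangentSpace I q →L[ℝ] TangentSpace I q →L[ℝ] ℝ :=
      bundleMetric h.inner k.inner lam'
    (∀ j : ℕ,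
      Integrable (fun q => scalarCurvature I g q ^ j) (riemannianVolume I g) ∧
      Integrable (fun q => scalarCurvature I g' q ^ j) (riemannianVolume I g') ∧
      ∫ q, scalarCurvature I g q ^ j ∂(riemannianVolume I g) =
        ∫ q, scalarCurvature I g' q ^ j ∂(riemannianVolume I g')) ∧
    range (scalarCurvature I g) = range (scalarCurvature I g') :=
  theorem2p11_general h k.inner (k.symm 1) (k.pos 1) lam lam' hlam hlam' hiso
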